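/- \textbf{Setting.} Let $n\in\mathbb N$ and $\mathcal S=\mathbb R^n$ with the Euclidean inner product; row vectors $\mathbf p$ are identified with elements of $\mathbb R^n$, so $\mathbf p\mathbf s$ is the inner product. Let $A:\mathbb R\to\mathbb R^{n\times n}$ be measurable and locally integrable on $[0,\infty)$, $\mathbf s_0\in\mathbb R^n$, and $\mathcal U\subset\mathbb R^n$ nonempty and compact. Admissible controls are the measurable functions $u$ with $u(\tau)\in\mathcal U$ for all $\tau\ge 0$; $s(\cdot;u)$ is the absolutely continuous solution of $\dot s=A s+u$, $s(0)=\mathbf s_0$, and $\mathcal R(t)=\{s(t;u): u \text{ admissible}\}$. Let $\mathcal G(t)\subset\mathbb R^n$, $t\in\mathbb R$, be a moving target set. Assume (RP1, normality) for all $t\ge0$ and admissible $u_1,u_2$: if $s(t;u_1)=s(t;u_2)\in\partial\mathcal R(t)$, then $u_1=u_2$ a.e. on $[0,t]$; (RT1) $\mathcal G(t)$ is a nonempty strictly convex compact set for every $t\in\mathbb R$. For a set $\mathcal M$ let $\boldsymbol s_{\mathcal M}(\mathbf p)=\arg\max_{\mathbf s\in\mathcal M}\mathbf p\mathbf s$ be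 its contact function. For $\mathbf p\ne0$ put $w(t,\mathbf p)=\boldsymbol s_{\mathcal G(t)}(-\mathbf p)-\boldsymbol s_{\mathcal R(t)}(\mathbf p)$, $$\rho_{\rm lower}(t,\mathbf p)=\frac{\mathbf p}{\|\mathbf p\|}\,w(t,\mathbf p),\quad \rho_{\rm upper}(t,\mathbf p)=\|w(t,\mathbf p)\|,\quad \delta=\rho_{\rm upper}-\rho_{\rm lower},\quad \boldsymbol q(t,\mathbf p)=\frac{w(t,\mathbf p)}{\|w(t,\mathbf p)\|}-\mathbf p,$$ $$\xi(\gamma;t,\mathbf p)=\|\mathbf p+\gamma\boldsymbol q(t,\mathbf p)\|\,\rho_{\rm lower}(t,\mathbf p+\gamma\boldsymbol q(t,\mathbf p))-\rho_{\rm lower}(t,\mathbf p),\qquad \xi'=\partial\xi/\partial\gamma .$$ \textbf{Algorithm} $\mathbf{SA}_\alpha(t,\mathbf p;\gamma)$. While $\delta(t,\mathbf p)>\alpha\rho_{\rm lower}(t,\mathbf p)$: first, while $\xi'(\gamma;t,\mathbf p)<0$, replace $\gamma$ by $\gamma/2$; then replace $\mathbf p$ by $\dfrac{\mathbf p+\gamma\boldsymbol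 q(t,\mathbf p)}{\|\mathbf p+\gamma\boldsymbol q(t,\mathbf p)\|}$. Output: $\mathbf p$. The halved step size is either kept for the next pass of the outer loop, or reset to the initial $\gamma$ after each update of $\mathbf p$; the theorem is asserted for both versions. \textbf{Theorem.} Let $t\ge0$, $\gamma\in(0,1)$, $\|\mathbf p\|=1$, $\rho_{\rm lower}(t,\mathbf p)\ge0$ and $\mathcal R(t)\cap\mathcal G(t)=\varnothing$. Then for every $\alpha>0$ the algorithm terminates after finitely many iterations (of the inner and outer loops together), and its output $\hat{\mathbf p}=\mathbf{SA}_\alpha(t,\mathbf p;\gamma)$ satisfies $\delta(t,\hat{\mathbf p})\le\alpha\,\rho_{\rm lower}(t,\hat{\mathbf p})$. Moreover the limit $\tilde{\mathbf p}=\lim_{\alpha\to+0}\mathbf{SA}_\alpha(t,\mathbf p;\gamma)$ exists, $\|\tilde{\mathbf p}\|=1$, and $\delta(t,\tilde{\mathbf p})=0$. Consequently $\rho_{\rm lower}(t,\tilde{\mathbf p})>0$, and $\boldsymbol s_{\mathcal R(t)}(\tilde{\mathbf p})\in\mathcal R(t)$ and $\boldsymbol s_{\mathcal G(t)}(-\tilde{\mathbf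 p})\in\mathcal G(t)$ are nearest points: $\|\boldsymbol s_{\mathcal G(t)}(-\tilde{\mathbf p})-\boldsymbol s_{\mathcal R(t)}(\tilde{\mathbf p})\|\le\|\mathbf y-\mathbf x\|$ for all $\mathbf x\in\mathcal R(t)$, $\mathbf y\in\mathcal G(t)$. -/

import Mathlib

open MeasureTheory Filter Topology

noncomputable section

/-- Data of a minimum-time problem for the linear system `s' = A(t) s + u` on `ℝⁿ`, with initial
state `s₀`, compact control set `U`, and moving target set `G(t)`. The regularity required of `A`
is what is needed for the fundamental solution matrix to exist.
Row vectors `p` are identified with elements of `ℝⁿ` through the inner product. -/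
structure LinearTimeProblem (n : ℕ) where
  A : ℝ → Matrix (Fin n) (Fin n) ℝ
  s₀ : EuclideanSpace ℝ (Fin n)
  U : Set (EuclideanSpace ℝ (Fin n))
  G : ℝ → Set (EuclideanSpace ℝ (Fin n))
  measurable_A : ∀ i j, Measurable fun τ => A τ i j
  locallyIntegrable_A : ∀ i j, LocallyIntegrableOn (fun τ => A τ i j) (Set.Ici 0) volume
  isCompact_U : IsCompact U
  nonempty_U : U.Nonempty

/-- `p ↦ argmax_{s ∈ M} ⟨p, s⟩`, the contact function of `M`. The maximizer exists and is unique if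
`M` is nonempty, compact and strictly convex and `p ≠ 0`. -/
def contactPoint {n : ℕ} (M : Set (EuclideanSpace ℝ (Fin n))) (p : EuclideanSpace ℝ (Fin n)) :
    EuclideanSpace ℝ (Fin n) :=
  Classical.epsilon fun s => s ∈ M ∧ ∀ x ∈ M, inner ℝ p x ≤ inner ℝ p s

namespace LinearTimeProblem

variable {n : ℕ} (P : LinearTimeProblem n)

/-- Admissible controls: measurable functions with values in `U` at all times `t ≥ 0`. -/
def Admissible (u : ℝ → EuclideanSpace ℝ (Fin n)) : Prop :=
  Measurable u ∧ ∀ τ, 0 ≤ τ → u τ ∈ P.U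

/-- `s` is, on `[0, ∞)`, the (locally) absolutely continuous solution of `s' = A s + u`,
`s(0) = s₀`, in Carathéodory's integral form. -/
def IsTrajectory (u s : ℝ → EuclideanSpace ℝ (Fin n)) : Prop :=
  ∀ t, 0 ≤ t →
    IntervalIntegrable (fun τ => Matrix.toEuclideanLin (P.A τ) (s τ) + u τ) volume 0 t ∧
    s t = P.s₀ + ∫ τ in (0 : ℝ)..t, (Matrix.toEuclideanLin (P.A τ) (s τ) + u τ)

/-- The reachable set `R(t)`. -/
def reachableSet (t : ℝ) : Set (EuclideanSpace ℝ (Fin n)) :=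
  {x | ∃ u s, P.Admissible u ∧ P.IsTrajectory u s ∧ s t = x}

/-- Normality: a boundary point of `R(t)` is reached by one control only (up to null sets). -/
def Normality : Prop :=
  ∀ t, 0 ≤ t → ∀ u₁ u₂ s₁ s₂, P.Admissible u₁ → P.Admissible u₂ →
    P.IsTrajectory u₁ s₁ → P.IsTrajectory u₂ s₂ →
    s₁ t = s₂ t → s₁ t ∈ frontier (P.reachableSet t) →
    ∀ᵐ τ ∂(volume.restrict (Set.Icc 0 t)), u₁ τ = u₂ τ

/-- Simple target geometry: every `G(t)` is a (nonempty) strictly convex compact set. -/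
def SimpleTarget : Prop :=
  ∀ t, (P.G t).Nonempty ∧ IsCompact (P.G t) ∧ StrictConvex ℝ (P.G t)

/-- The contact point `s_{R(t)}(p)`. -/
def contactR (t : ℝ) (p : EuclideanSpace ℝ (Fin n)) : EuclideanSpace ℝ (Fin n) :=
  contactPoint (P.reachableSet t) p

/-- The contact point `s_{G(t)}(p)`. -/
def contactG (t : ℝ) (p : EuclideanSpace ℝ (Fin n)) : EuclideanSpace ℝ (Fin n) :=
  contactPoint (P.G t) p

/-- `ρ_lower(t, p) = (p / ‖p‖) (s_{G(t)}(-p) - s_{R(t)}(p))`. -/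
def rhoLower (t : ℝ) (p : EuclideanSpace ℝ (Fin n)) : ℝ :=
  inner ℝ p (P.contactG t (-p) - P.contactR t p) / ‖p‖

/-- `ρ_upper(t, p) = ‖s_{G(t)}(-p) - s_{R(t)}(p)‖`. -/
def rhoUpper (t : ℝ) (p : EuclideanSpace ℝ (Fin n)) : ℝ :=
  ‖P.contactG t (-p) - P.contactR t p‖

/-- `δ = ρ_upper - ρ_lower`. -/
def delta (t : ℝ) (p : EuclideanSpace ℝ (Fin n)) : ℝ :=
  P.rhoUpper t p - P.rhoLower t p

/-- The ascent direction
`q(t, p) = (s_{G(t)}(-p) - s_{R(t)}(p)) / ‖s_{G(t)}(-p) - s_{R(t)}(p)‖ - p`. -/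
def direction (t : ℝ) (p : EuclideanSpace ℝ (Fin n)) : EuclideanSpace ℝ (Fin n) :=
  ‖P.contactG t (-p) - P.contactR t p‖⁻¹ • (P.contactG t (-p) - P.contactR t p) - p

/-- `ξ(γ; t, p) = ‖p + γ q(t, p)‖ ρ_lower(t, p + γ q(t, p)) - ρ_lower(t, p)`. -/
def xi (γ t : ℝ) (p : EuclideanSpace ℝ (Fin n)) : ℝ :=
  ‖p + γ • P.direction t p‖ * P.rhoLower t (p + γ • P.direction t p) - P.rhoLower t p

/-- `ξ'(γ; t, p) = ∂ξ/∂γ (γ; t, p)`. -/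
def xiDeriv (γ t : ℝ) (p : EuclideanSpace ℝ (Fin n)) : ℝ :=
  deriv (fun g => P.xi g t p) γ

open Classical in
/-- One elementary step of the steepest ascent algorithm on the state `(p, γ)`.
If the stopping test `δ ≤ α ρ_lower` fails, then: if `ξ'(γ; t, p) < 0`, this is one pass of the
inner loop, `γ ← γ / 2`; otherwise the inner loop is over and `p` is moved along `q(t, p)` with
step size `γ` and normalized. The next line search starts from the current step size if
`keep = true`, and from the initial step size `γ₀` if `keep = false`.
If the stopping test succeeds, the state does not change any more. -/
def saStep (keep : Bool) (α t γ₀ : ℝ) (x : EuclideanSpace ℝ (Fin n) × ℝ) :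
    EuclideanSpace ℝ (Fin n) × ℝ :=
  if P.delta t x.1 > α * P.rhoLower t x.1 then
    if P.xiDeriv x.2 t x.1 < 0 then (x.1, x.2 / 2)
    else (‖x.1 + x.2 • P.direction t x.1‖⁻¹ • (x.1 + x.2 • P.direction t x.1),
      if keep then x.2 else γ₀)
  else x

/-- State after `k` elementary steps, started from `(p, γ)`. -/
def saState (keep : Bool) (α t : ℝ) (p : EuclideanSpace ℝ (Fin n)) (γ : ℝ) (k : ℕ) :
    EuclideanSpace ℝ (Fin n) × ℝ :=
  (P.saStep keep α t γ)^[k] (p, γ)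

/-- The outer loop is left after at most `k` elementary steps. -/
def SAHalted (keep : Bool) (α t : ℝ) (p : EuclideanSpace ℝ (Fin n)) (γ : ℝ) (k : ℕ) : Prop :=
  ¬ P.delta t (P.saState keep α t p γ k).1 > α * P.rhoLower t (P.saState keep α t p γ k).1

open Classical in
/-- The output `SA_α(t, p; γ)`: the vector `p` at the moment the outer loop is left (`0` if that
never happens). -/
def saOutput (keep : Bool) (α t : ℝ) (p : EuclideanSpace ℝ (Fin n)) (γ : ℝ) :
    EuclideanSpace ℝ (Fin n) :=
  if h : ∃ k, P.SAHalted keep α t p γ k then (P.saState keep α t p γ (Nat.find h)).1 else 0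

end LinearTimeProblem

end

/-! Put `h(p) = ⟨p, gap p⟩`. Since each contact point optimizes its own half, `h(p)` is the minimum
of `⟨p, y - x⟩` over `x ∈ R(t)`, `y ∈ G(t)`. So `h` is concave and positively homogeneous, `gap p`
is a supergradient of `h` at `p` (`SimpleTarget.inner_gap_le`), and `h(p) ≤ ‖y - x‖` for unit `p`.
The bound is attained once `gap p` is a positive multiple of `p`, that is, once `δ = 0`. The
algorithm is ascent on `h`, and neither compactness nor convexity of `R(t)` is needed.

Everything rests on continuity of `gap` away from `0`: it makes `h` differentiable, with `ξ'(γ) =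
⟨q, gap (p + γ q)⟩` and `ξ'(0) = δ`. For `G(t)` continuity follows from strict convexity. For `R(t)`
it must be extracted from normality, which speaks of controls reaching the same point and not of
uniqueness of contact points. Cauchy's formula writes endpoints as `c + ∫ F u`, so a control
maximizing `⟨F(τ)ᵀ p, ·⟩` over `U` at every time reaches a contact point. Given two such controls,
Lyapunov's theorem yields a set on which `∫ F (u₁ - u₂)` is exactly halved; exchanging the controls
there and on the complement gives two maximizing controls with one common endpoint, on the frontier.
Normality identifies these, hence also `u₁` and `u₂`. Thus the pointwise maximizer is unique at
almost every time, and dominated convergence gives continuity of `contactR`.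

Termination: before the stop, `δ` exceeds a positive constant, because `‖gap‖` is bounded below on
the sphere. By uniform continuity `ξ'` is then bounded below for all small steps, so step sizes do
not shrink to zero and each move raises `ρ_lower`, which is bounded, by a fixed amount. Convergence:
the outputs have `δ → 0`, at most one unit vector has `δ = 0`, and the sphere is compact. -/

noncomputable section

/-! ### Linear Volterra equations with integrable kernels -/

/-- Product rule for primitives of integrable functions. -/
lemma primitive_mul_primitive {f g : ℝ → ℝ} {a b : ℝ} (c d : ℝ)
    (hf : IntervalIntegrable f volume a b) (hg : IntervalIntegrable g volume a b) :
    (c + ∫ τ in a..b, f τ) * (d + ∫ τ in a..b, g τ) - c * d =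
      ∫ τ in a..b, (f τ * (d + ∫ σ in a..τ, g σ) + (c + ∫ σ in a..τ, f σ) * g τ) := by
  have hconst : ∀ c : ℝ, AbsolutelyContinuousOnInterval (fun _ : ℝ => c) a b := fun c =>
    ContDiffOn.absolutelyContinuousOnInterval contDiffOn_const
  have hF := (hconst c).add
    (hf.absolutelyContinuousOnInterval_intervalIntegral Set.left_mem_uIcc)
  have hG := (hconst d).add
    (hg.absolutelyContinuousOnInterval_intervalIntegral Set.left_mem_uIcc)
  have h := AbsolutelyContinuousOnInterval.integral_deriv_mul_eq_sub hF hG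
  simp only [Pi.add_apply, intervalIntegral.integral_same, add_zero] at h
  rw [← h]
  apply intervalIntegral.integral_congr_ae
  filter_upwards [hf.ae_hasDerivAt_integral, hg.ae_hasDerivAt_integral] with x h1 h2 hx
  have hx' := Set.uIoc_subset_uIcc hx
  have e1 := ((h1 hx' a Set.left_mem_uIcc).const_add c).deriv
  have e2 := ((h2 hx' a Set.left_mem_uIcc).const_add d).deriv
  have e1' : deriv ((fun _ => c) + fun x => ∫ v in a..x, f v) x = f x := e1
  have e2' : deriv ((fun _ => d) + fun x => ∫ v in a..x, g v) x = g x := e2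
  rw [e1', e2']

/-- The primitive is only absolutely continuous, so the power rule comes from the product rule for
primitives by induction, with `b` free because the hypothesis is needed on every `[a, τ]`. It
produces the factorials in the Picard bound. -/
lemma integral_primitive_pow_mul {l : ℝ → ℝ} {a b : ℝ} (hl : IntervalIntegrable l volume a b)
    (k : ℕ) :
    ∫ τ in a..b, l τ * (∫ σ in a..τ, l σ) ^ k = (∫ τ in a..b, l τ) ^ (k + 1) / (k + 1) := by
  induction k generalizing b with
  | zero => simp
  | succ k ih =>
    have hsub : ∀ τ ∈ Set.uIcc a b, IntervalIntegrable l volume a τ := fun τ hτ =>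
      hl.mono_set (Set.uIcc_subset_uIcc_left hτ)
    have hcont : ContinuousOn (fun τ => ∫ σ in a..τ, l σ) (Set.uIcc a b) :=
      (hl.absolutelyContinuousOnInterval_intervalIntegral Set.left_mem_uIcc).continuousOn
    have hg : IntervalIntegrable (fun τ => l τ * (∫ σ in a..τ, l σ) ^ k) volume a b :=
      hl.mul_continuousOn (hcont.pow k)
    have h := primitive_mul_primitive 0 0 hl hg
    simp only [zero_add, mul_zero, sub_zero] at h
    rw [ih hl] at h
    have e : ∫ τ in a..b, (l τ * (∫ σ in a..τ, l σ * (∫ σ' in a..σ, l σ') ^ k) +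
        (∫ σ in a..τ, l σ) * (l τ * (∫ σ in a..τ, l σ) ^ k)) =
        ∫ τ in a..b, ((1 / ((k : ℝ) + 1) + 1) * (l τ * (∫ σ in a..τ, l σ) ^ (k + 1))) := by
      apply intervalIntegral.integral_congr
      intro τ hτ
      simp only
      rw [ih (hsub τ hτ)]
      ring
    rw [e, intervalIntegral.integral_const_mul] at h
    have hk : (0 : ℝ) < k + 1 := by positivity
    have hk' : (0 : ℝ) < k + 1 + 1 := by positivity
    push_cast
    field_simp at h ⊢
    linear_combination -h

section Volterra

variable {E : Type*} [NormedAddCommGroup E] [NormedSpace ℝ E]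

lemma IntervalIntegrable.clm_apply_continuous {L : ℝ → E →L[ℝ] E} {x : ℝ → E} {a b : ℝ}
    (hL : IntervalIntegrable L volume a b) (hx : ContinuousOn x (Set.uIcc a b)) :
    IntervalIntegrable (fun τ => L τ (x τ)) volume a b := by
  obtain ⟨C, hC⟩ := isCompact_uIcc.exists_bound_of_continuousOn hx
  have hm : AEStronglyMeasurable (fun τ => L τ (x τ)) (volume.restrict (Set.uIoc a b)) := by
    refine (isBoundedBilinearMap_apply (𝕜 := ℝ) (E := E) (F := E)).continuous
      |>.comp_aestronglyMeasurable
      ((intervalIntegrable_iff.1 hL).aestronglyMeasurable.prodMk ?_)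
    exact (hx.mono Set.uIoc_subset_uIcc).aestronglyMeasurable_of_isSeparable
      measurableSet_uIoc (TopologicalSpace.IsSeparable.of_separableSpace _)
  refine (hL.norm.mul_const C).mono_fun hm ?_
  filter_upwards [ae_restrict_mem measurableSet_uIoc] with τ hτ
  have h := hC τ (Set.uIoc_subset_uIcc hτ)
  have hC0 : 0 ≤ C := (norm_nonneg _).trans h
  rw [norm_mul, norm_norm, Real.norm_of_nonneg hC0]
  exact ((L τ).le_opNorm _).trans (by gcongr)

/-- Picard terms for the Volterra equation `x = g + ∫ L x`. -/
def picardTerm (L : ℝ → E →L[ℝ] E) (g : ℝ → E) : ℕ → ℝ → E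
  | 0 => g
  | k + 1 => fun t => ∫ τ in (0 : ℝ)..t, L τ (picardTerm L g k τ)

variable {L : ℝ → E →L[ℝ] E} {g : ℝ → E}

lemma continuous_picardTerm (hL : ∀ a b, IntervalIntegrable L volume a b) (hg : Continuous g)
    (k : ℕ) : Continuous (picardTerm L g k) := by
  induction k with
  | zero => exact hg
  | succ k ih =>
    exact intervalIntegral.continuous_primitive
      (fun a b => (hL a b).clm_apply_continuous ih.continuousOn) 0

lemma norm_picardTerm_le (hL : ∀ a b, IntervalIntegrable L volume a b) (hg : Continuous g)
    {C T : ℝ} (hC : ∀ τ ∈ Set.Icc 0 T, ‖g τ‖ ≤ C) (k : ℕ) :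
    ∀ t ∈ Set.Icc 0 T,
      ‖picardTerm L g k t‖ ≤ C * ((∫ τ in (0 : ℝ)..t, ‖L τ‖) ^ k / k.factorial) := by
  induction k with
  | zero => simpa [picardTerm] using hC
  | succ k ih =>
    intro t ht
    have hc : Continuous fun t => ∫ τ in (0 : ℝ)..t, ‖L τ‖ :=
      intervalIntegral.continuous_primitive (fun a b => (hL a b).norm) 0
    calc ‖picardTerm L g (k + 1) t‖
        ≤ ∫ τ in (0 : ℝ)..t, ‖L τ (picardTerm L g k τ)‖ :=
          intervalIntegral.norm_integral_le_integral_norm ht.1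
      _ ≤ ∫ τ in (0 : ℝ)..t, C / k.factorial * (‖L τ‖ * (∫ σ in (0 : ℝ)..τ, ‖L σ‖) ^ k) := by
          refine intervalIntegral.integral_mono_on ht.1
            ((hL 0 t).clm_apply_continuous (continuous_picardTerm hL hg k).continuousOn).norm
            (((hL 0 t).norm.mul_continuousOn (hc.pow k).continuousOn).const_mul _) ?_
          intro τ hτ
          refine ((L τ).le_opNorm _).trans ?_
          have := ih τ ⟨hτ.1, hτ.2.trans ht.2⟩
          calc ‖L τ‖ * ‖picardTerm L g k τ‖
              ≤ ‖L τ‖ * (C * ((∫ σ in (0 : ℝ)..τ, ‖L σ‖) ^ k / k.factorial)) := by gcongr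
            _ = _ := by ring
      _ = _ := by
          rw [intervalIntegral.integral_const_mul, integral_primitive_pow_mul (hL 0 t).norm,
            Nat.factorial_succ]
          push_cast
          have : ((k : ℝ) + 1) ≠ 0 := by positivity
          field_simp

/-- Existence for a linear Volterra equation with locally integrable kernel. -/
theorem exists_volterra_solution [CompleteSpace E]
    (hL : ∀ a b, IntervalIntegrable L volume a b) (hg : Continuous g) :
    ∃ x : ℝ → E, Continuous x ∧ ∀ t, 0 ≤ t → x t = g t + ∫ τ in (0 : ℝ)..t, L τ (x τ) := by
  have hbound : ∀ T : ℝ, 0 ≤ T → ∃ u : ℕ → ℝ, Summable u ∧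
      ∀ k, ∀ t ∈ Set.Icc 0 T, ‖picardTerm L g k t‖ ≤ u k := by
    intro T hT
    obtain ⟨C, hC⟩ := (isCompact_Icc (a := (0 : ℝ)) (b := T)).exists_bound_of_continuousOn
      hg.continuousOn
    refine ⟨fun k => C * ((∫ τ in (0 : ℝ)..T, ‖L τ‖) ^ k / k.factorial),
      (Real.summable_pow_div_factorial _).mul_left C, fun k t ht => ?_⟩
    have hC0 : 0 ≤ C := (norm_nonneg _).trans (hC 0 ⟨le_rfl, hT⟩)
    refine (norm_picardTerm_le hL hg hC k t ht).trans ?_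
    have h0 : 0 ≤ ∫ τ in (0 : ℝ)..t, ‖L τ‖ :=
      intervalIntegral.integral_nonneg ht.1 fun _ _ => norm_nonneg _
    have h1 : ∫ τ in (0 : ℝ)..t, ‖L τ‖ ≤ ∫ τ in (0 : ℝ)..T, ‖L τ‖ :=
      intervalIntegral.integral_mono_interval le_rfl ht.1 ht.2
        (ae_of_all _ fun _ => norm_nonneg _) (hL 0 T).norm
    simp only
    gcongr
  set y : ℝ → E := fun t => ∑' k, picardTerm L g k t with hy
  have hycont : ∀ T : ℝ, 0 ≤ T → ContinuousOn y (Set.Icc 0 T) := by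
    intro T hT
    obtain ⟨u, hu, hk⟩ := hbound T hT
    exact continuousOn_tsum (fun k => (continuous_picardTerm hL hg k).continuousOn) hu
      fun k t ht => hk k t ht
  have hyeq : ∀ t : ℝ, 0 ≤ t → y t = g t + ∫ τ in (0 : ℝ)..t, L τ (y τ) := by
    intro t ht
    obtain ⟨u, hu, hk⟩ := hbound t ht
    have hs : ∀ τ ∈ Set.Icc 0 t, HasSum (fun k => picardTerm L g k τ) (y τ) := fun τ hτ =>
      (Summable.of_norm_bounded hu fun k => hk k τ hτ).hasSum
    have hint : HasSum (fun k => picardTerm L g (k + 1) t) (∫ τ in (0 : ℝ)..t, L τ (y τ)) := by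
      refine intervalIntegral.hasSum_integral_of_dominated_convergence
        (fun k τ => ‖L τ‖ * u k) (fun k => ?_) (fun k => ?_) ?_ ?_ ?_
      · exact (intervalIntegrable_iff.1 ((hL 0 t).clm_apply_continuous
          (continuous_picardTerm hL hg k).continuousOn)).aestronglyMeasurable
      · refine ae_of_all _ fun τ hτ => ((L τ).le_opNorm _).trans ?_
        rw [Set.uIoc_of_le ht] at hτ
        exact mul_le_mul_of_nonneg_left (hk k τ (Set.Ioc_subset_Icc_self hτ)) (norm_nonneg _)
      · exact ae_of_all _ fun τ _ => hu.mul_left _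
      · simp_rw [tsum_mul_left]
        exact (hL 0 t).norm.mul_const _
      · refine ae_of_all _ fun τ hτ => ?_
        rw [Set.uIoc_of_le ht] at hτ
        exact (hs τ (Set.Ioc_subset_Icc_self hτ)).mapL (L τ)
    have h0 := (hasSum_nat_add_iff' 1).2 (hs t ⟨ht, le_rfl⟩)
    have h1 := hint.unique h0
    simp only [Finset.range_one, Finset.sum_singleton] at h1
    rw [h1]
    simp [picardTerm]
  -- The series is controlled only for `t ≥ 0`; freezing it at its value at `0` for negative times
  -- makes the solution continuous on all of `ℝ`.
  refine ⟨fun t => y (max t 0), ?_, fun t ht => ?_⟩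
  · rw [continuous_iff_continuousAt]
    intro t
    have h1 : ContinuousOn (fun t => y (max t 0)) (Set.Iic (|t| + 1)) :=
      (hycont (|t| + 1) (by positivity)).comp (by fun_prop) fun s hs =>
        ⟨le_max_right _ _, max_le hs (by positivity)⟩
    exact h1.continuousAt (Iic_mem_nhds (by linarith [le_abs_self t]))
  · simp only
    rw [max_eq_left ht, hyeq t ht]
    congr 1
    refine intervalIntegral.integral_congr fun τ hτ => ?_
    rw [Set.uIcc_of_le ht] at hτ
    rw [max_eq_left hτ.1]

end Volterra

end

noncomputable section

/-! ### Trajectories and the endpoint formula -/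

variable {n : ℕ}

lemma inner_primitive_primitive {f g : ℝ → EuclideanSpace ℝ (Fin n)} {a b : ℝ}
    (c d : EuclideanSpace ℝ (Fin n)) (hf : IntervalIntegrable f volume a b)
    (hg : IntervalIntegrable g volume a b) :
    inner ℝ (c + ∫ τ in a..b, f τ) (d + ∫ τ in a..b, g τ) - inner ℝ c d =
      ∫ τ in a..b, (inner ℝ (f τ) (d + ∫ σ in a..τ, g σ) +
        inner ℝ (c + ∫ σ in a..τ, f σ) (g τ)) := by
  have proj_int : ∀ {f : ℝ → EuclideanSpace ℝ (Fin n)} (i : Fin n),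
      IntervalIntegrable f volume a b → IntervalIntegrable (fun τ => f τ i) volume a b :=
    fun i hf => ⟨(EuclideanSpace.proj (𝕜 := ℝ) i).integrable_comp hf.1,
      (EuclideanSpace.proj (𝕜 := ℝ) i).integrable_comp hf.2⟩
  have proj_eq : ∀ {f : ℝ → EuclideanSpace ℝ (Fin n)} (i : Fin n) {τ : ℝ}, τ ∈ Set.uIcc a b →
      IntervalIntegrable f volume a b → (∫ σ in a..τ, f σ) i = ∫ σ in a..τ, f σ i :=
    fun i τ hτ hf => ((EuclideanSpace.proj (𝕜 := ℝ) i).intervalIntegral_comp_comm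
      (hf.mono_set (Set.uIcc_subset_uIcc_left hτ))).symm
  have hcont : ∀ {f : ℝ → ℝ} (c : ℝ), IntervalIntegrable f volume a b →
      ContinuousOn (fun τ => c + ∫ σ in a..τ, f σ) (Set.uIcc a b) := fun c hf =>
    continuousOn_const.add
      (hf.absolutelyContinuousOnInterval_intervalIntegral Set.left_mem_uIcc).continuousOn
  have h1 : inner ℝ (c + ∫ τ in a..b, f τ) (d + ∫ τ in a..b, g τ) - inner ℝ c d =
      ∑ i, ∫ τ in a..b, (f τ i * (d i + ∫ σ in a..τ, g σ i) +
        (c i + ∫ σ in a..τ, f σ i) * g τ i) := by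
    rw [PiLp.inner_apply, PiLp.inner_apply, ← Finset.sum_sub_distrib]
    refine Finset.sum_congr rfl fun i _ => ?_
    rw [← primitive_mul_primitive (c i) (d i) (proj_int i hf) (proj_int i hg),
      ← proj_eq i Set.right_mem_uIcc hf, ← proj_eq i Set.right_mem_uIcc hg]
    simp only [PiLp.add_apply, RCLike.inner_apply, conj_trivial]
    ring
  rw [h1, ← intervalIntegral.integral_finsetSum]
  · refine intervalIntegral.integral_congr fun τ hτ => ?_
    simp only [PiLp.inner_apply, PiLp.add_apply, RCLike.inner_apply, conj_trivial]
    rw [← Finset.sum_add_distrib]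
    refine Finset.sum_congr rfl fun i _ => ?_
    rw [proj_eq i hτ hf, proj_eq i hτ hg]
    ring
  · intro i _
    exact ((proj_int i hf).mul_continuousOn (hcont _ (proj_int i hg))).add
      ((proj_int i hg).continuousOn_mul (hcont _ (proj_int i hf)))

/-- The continuous linear map of a matrix. -/
def matrixCLM : Matrix (Fin n) (Fin n) ℝ →ₗ[ℝ]
    (EuclideanSpace ℝ (Fin n) →L[ℝ] EuclideanSpace ℝ (Fin n)) :=
  LinearMap.toContinuousLinearMap.toLinearMap ∘ₗ Matrix.toEuclideanLin.toLinearMap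

@[simp] lemma matrixCLM_apply (M : Matrix (Fin n) (Fin n) ℝ) (x : EuclideanSpace ℝ (Fin n)) :
    matrixCLM M x = Matrix.toEuclideanLin M x := rfl

lemma inner_matrixCLM_transpose (M : Matrix (Fin n) (Fin n) ℝ) (x y : EuclideanSpace ℝ (Fin n)) :
    inner ℝ (matrixCLM M.transpose x) y = inner ℝ x (matrixCLM M y) := by
  rw [matrixCLM_apply, matrixCLM_apply, ← Matrix.conjTranspose_eq_transpose_of_trivial,
    Matrix.toEuclideanLin_conjTranspose_eq_adjoint, LinearMap.adjoint_inner_left]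

lemma intervalIntegrable_sum_smul {E ι : Type*} [NormedAddCommGroup E] [NormedSpace ℝ E]
    [Fintype ι] {c : ι → ℝ → ℝ} (e : ι → E) {a b : ℝ}
    (hc : ∀ i, IntervalIntegrable (c i) volume a b) :
    IntervalIntegrable (fun τ => ∑ i, c i τ • e i) volume a b :=
  ⟨integrable_finsetSum _ fun i _ => (hc i).1.smul_const _,
    integrable_finsetSum _ fun i _ => (hc i).2.smul_const _⟩

lemma matrixCLM_eq_sum (M : Matrix (Fin n) (Fin n) ℝ) :
    matrixCLM M =
      ∑ ij : Fin n × Fin n, M ij.1 ij.2 • matrixCLM (Matrix.single ij.1 ij.2 (1 : ℝ)) := by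
  conv_lhs => rw [Matrix.matrix_eq_sum_single M]
  rw [Fintype.sum_prod_type]
  simp only [map_sum, ← map_smul, Matrix.smul_single, smul_eq_mul, mul_one]

lemma intervalIntegrable_matrixCLM {M : ℝ → Matrix (Fin n) (Fin n) ℝ} {a b : ℝ}
    (hM : ∀ i j, IntervalIntegrable (fun τ => M τ i j) volume a b) :
    IntervalIntegrable (fun τ => matrixCLM (M τ)) volume a b := by
  have h := intervalIntegrable_sum_smul (c := fun (ij : Fin n × Fin n) τ => M τ ij.1 ij.2)
    (fun ij => matrixCLM (Matrix.single ij.1 ij.2 (1 : ℝ))) fun ij => hM ij.1 ij.2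
  have e : (fun τ => matrixCLM (M τ)) = fun τ => ∑ ij : Fin n × Fin n,
      M τ ij.1 ij.2 • matrixCLM (Matrix.single ij.1 ij.2 (1 : ℝ)) :=
    funext fun τ => matrixCLM_eq_sum (M τ)
  rw [e]
  exact h

lemma IntervalIntegrable.continuous_clm_apply
    {F : ℝ → EuclideanSpace ℝ (Fin n) →L[ℝ] EuclideanSpace ℝ (Fin n)}
    {u : ℝ → EuclideanSpace ℝ (Fin n)} {a b : ℝ} (hF : Continuous F)
    (hu : IntervalIntegrable u volume a b) :
    IntervalIntegrable (fun τ => F τ (u τ)) volume a b := by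
  obtain ⟨C, hC⟩ := isCompact_uIcc.exists_bound_of_continuousOn (s := Set.uIcc a b) hF.continuousOn
  refine (hu.norm.const_mul C).mono_fun ?_ ?_
  · exact (isBoundedBilinearMap_apply (𝕜 := ℝ) (E := EuclideanSpace ℝ (Fin n))
      (F := EuclideanSpace ℝ (Fin n))).continuous.comp_aestronglyMeasurable
      (hF.aestronglyMeasurable.prodMk (intervalIntegrable_iff.1 hu).aestronglyMeasurable)
  · filter_upwards [ae_restrict_mem measurableSet_uIoc] with τ hτ
    have h := hC τ (Set.uIoc_subset_uIcc hτ)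
    have hC0 : 0 ≤ C := (norm_nonneg _).trans h
    rw [norm_mul, norm_norm, Real.norm_of_nonneg hC0]
    exact ((F τ).le_opNorm _).trans (by gcongr)

namespace LinearTimeProblem

variable (P : LinearTimeProblem n)

/-- The system matrix, extended by zero to negative times. -/
def posA (τ : ℝ) : Matrix (Fin n) (Fin n) ℝ := (Set.Ici (0 : ℝ)).indicator P.A τ

lemma posA_of_nonneg {τ : ℝ} (hτ : 0 ≤ τ) : P.posA τ = P.A τ := Set.indicator_of_mem hτ _

lemma intervalIntegrable_posA (i j : Fin n) (a b : ℝ) :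
    IntervalIntegrable (fun τ => P.posA τ i j) volume a b := by
  have e : (fun τ => P.posA τ i j) = (Set.Ici (0 : ℝ)).indicator fun τ => P.A τ i j := by
    funext τ
    by_cases hτ : τ ∈ Set.Ici (0 : ℝ) <;> simp [posA, hτ]
  rw [e, intervalIntegrable_iff']
  refine IntegrableOn.mono_set ?_ (Set.subset_union_left (t := Set.uIcc a b ∩ Set.Ici 0))
  rw [Set.union_eq_left.2 Set.inter_subset_left, IntegrableOn,
    integrable_indicator_iff measurableSet_Ici, IntegrableOn,
    Measure.restrict_restrict measurableSet_Ici]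
  exact ((P.locallyIntegrable_A i j).integrableOn_compact_subset Set.inter_subset_left
    (isCompact_uIcc.inter_left isClosed_Ici))

variable {P}

lemma Admissible.intervalIntegrable_indicator {u : ℝ → EuclideanSpace ℝ (Fin n)}
    (hu : P.Admissible u) (a b : ℝ) :
    IntervalIntegrable ((Set.Ici (0 : ℝ)).indicator u) volume a b := by
  obtain ⟨C, hC0, hC⟩ := P.isCompact_U.isBounded.exists_pos_norm_le
  refine (intervalIntegrable_const (c := C)).mono_fun
    ((hu.1.indicator measurableSet_Ici).aestronglyMeasurable) (ae_of_all _ fun τ => ?_)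
  simp only [Real.norm_of_nonneg hC0.le]
  by_cases hτ : τ ∈ Set.Ici (0 : ℝ)
  · rw [Set.indicator_of_mem hτ]
    exact hC _ (hu.2 τ hτ)
  · rw [Set.indicator_of_notMem hτ]
    simpa using hC0.le

lemma Admissible.intervalIntegrable {u : ℝ → EuclideanSpace ℝ (Fin n)}
    (hu : P.Admissible u) {t : ℝ} (ht : 0 ≤ t) : IntervalIntegrable u volume 0 t := by
  refine (hu.intervalIntegrable_indicator 0 t).congr fun τ hτ => ?_
  rw [Set.uIoc_of_le ht] at hτ
  exact Set.indicator_of_mem (Set.mem_Ici.2 hτ.1.le) u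

/-- Every admissible control has a trajectory. -/
theorem Admissible.exists_isTrajectory {u : ℝ → EuclideanSpace ℝ (Fin n)}
    (hu : P.Admissible u) : ∃ s, P.IsTrajectory u s := by
  have hL : ∀ a b, IntervalIntegrable (fun τ => matrixCLM (P.posA τ)) volume a b := fun a b =>
    intervalIntegrable_matrixCLM fun i j => P.intervalIntegrable_posA i j a b
  obtain ⟨x, hx, heq⟩ := exists_volterra_solution hL
    (g := fun t => P.s₀ + ∫ τ in (0 : ℝ)..t, (Set.Ici (0 : ℝ)).indicator u τ)
    (continuous_const.add (intervalIntegral.continuous_primitive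
      hu.intervalIntegrable_indicator 0))
  refine ⟨x, fun t ht => ?_⟩
  have hi := ((hL 0 t).clm_apply_continuous hx.continuousOn).add
    (hu.intervalIntegrable_indicator 0 t)
  have hc : Set.EqOn (fun τ => matrixCLM (P.posA τ) (x τ) + (Set.Ici (0 : ℝ)).indicator u τ)
      (fun τ => Matrix.toEuclideanLin (P.A τ) (x τ) + u τ) (Set.uIcc 0 t) := by
    intro τ hτ
    rw [Set.uIcc_of_le ht] at hτ
    simp only [matrixCLM_apply, P.posA_of_nonneg hτ.1, Set.indicator_of_mem (Set.mem_Ici.2 hτ.1)]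
  refine ⟨hi.congr (hc.mono Set.uIoc_subset_uIcc), ?_⟩
  rw [heq t ht, ← intervalIntegral.integral_congr hc, intervalIntegral.integral_add
    ((hL 0 t).clm_apply_continuous hx.continuousOn) (hu.intervalIntegrable_indicator 0 t)]
  abel

/-- Time is reversed, so that the adjoint equation with end value `e` at `t` becomes a forward
Volterra equation for `φ`. In the derivative of `⟨φ(σ), s(t - σ)⟩` the terms with `A` cancel, which
leaves `-⟨φ(σ), u(t - σ)⟩`. -/
lemma exists_adjoint_solution (P : LinearTimeProblem n) {t : ℝ} (ht : 0 ≤ t)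
    (e : EuclideanSpace ℝ (Fin n)) :
    ∃ ψ : ℝ → EuclideanSpace ℝ (Fin n), Continuous ψ ∧ ∀ u s, P.Admissible u →
      P.IsTrajectory u s →
        inner ℝ e (s t) = inner ℝ (ψ 0) P.s₀ + ∫ τ in (0 : ℝ)..t, inner ℝ (ψ τ) (u τ) := by
  have hL : ∀ a b, IntervalIntegrable (fun σ => matrixCLM (P.posA (t - σ)).transpose) volume a b :=
    fun a b => intervalIntegrable_matrixCLM fun i j => by
      simpa using (P.intervalIntegrable_posA j i (t - a) (t - b)).comp_sub_left t
  obtain ⟨φ, hφ, heq⟩ := exists_volterra_solution hL (g := fun _ => e) continuous_const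
  refine ⟨fun τ => φ (t - τ), hφ.comp (by fun_prop), fun u s hu hs => ?_⟩
  set f : ℝ → EuclideanSpace ℝ (Fin n) := fun σ => matrixCLM (P.posA (t - σ)).transpose (φ σ)
    with hf
  set v : ℝ → EuclideanSpace ℝ (Fin n) := fun τ => Matrix.toEuclideanLin (P.A τ) (s τ) + u τ
    with hv
  have hfi : IntervalIntegrable f volume 0 t := (hL 0 t).clm_apply_continuous hφ.continuousOn
  have hvi : IntervalIntegrable v volume 0 t := (hs t ht).1
  have hgi : IntervalIntegrable (fun σ => -v (t - σ)) volume 0 t := by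
    have h := (hvi.comp_sub_left t).neg.symm
    simpa [Function.comp_def] using! h
  have hG : ∀ σ ∈ Set.uIcc 0 t, s t + ∫ σ' in (0 : ℝ)..σ, -v (t - σ') = s (t - σ) := by
    intro σ hσ
    rw [Set.uIcc_of_le ht] at hσ
    rw [intervalIntegral.integral_neg, intervalIntegral.integral_comp_sub_left (fun τ => v τ) t,
      sub_zero, (hs t ht).2, (hs (t - σ) (by linarith [hσ.2])).2]
    have hsub : IntervalIntegrable v volume 0 (t - σ) := (hs (t - σ) (by linarith [hσ.2])).1
    rw [← intervalIntegral.integral_interval_sub_left hvi hsub]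
    abel
  have hF : ∀ σ ∈ Set.uIcc 0 t, e + ∫ σ' in (0 : ℝ)..σ, f σ' = φ σ := by
    intro σ hσ
    rw [Set.uIcc_of_le ht] at hσ
    exact (heq σ hσ.1).symm
  have h := inner_primitive_primitive e (s t) hfi hgi
  rw [hF t Set.right_mem_uIcc, hG t Set.right_mem_uIcc] at h
  have hcongr : ∫ σ in (0 : ℝ)..t, (inner ℝ (f σ) (s t + ∫ σ' in (0 : ℝ)..σ, -v (t - σ')) +
      inner ℝ (e + ∫ σ' in (0 : ℝ)..σ, f σ') (-v (t - σ))) =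
      ∫ σ in (0 : ℝ)..t, -(fun τ => inner ℝ (φ (t - τ)) (u τ)) (t - σ) := by
    refine intervalIntegral.integral_congr fun σ hσ => ?_
    simp only
    rw [hG σ hσ, hF σ hσ]
    rw [Set.uIcc_of_le ht] at hσ
    simp only [hf, hv, inner_matrixCLM_transpose, P.posA_of_nonneg (sub_nonneg.2 hσ.2),
      inner_neg_right, inner_add_right, sub_sub_cancel]
    rw [matrixCLM_apply]
    ring
  rw [hcongr, intervalIntegral.integral_neg,
    intervalIntegral.integral_comp_sub_left (fun τ => inner ℝ (φ (t - τ)) (u τ)) t] at h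
  have hs0 : s 0 = P.s₀ := by simpa using (hs 0 le_rfl).2
  simp only [sub_self, sub_zero, hs0] at h ⊢
  linarith

/-- Cauchy's formula: the endpoint of a trajectory is an integral of the control against a
continuous kernel. -/
theorem exists_endpoint_kernel (P : LinearTimeProblem n) {t : ℝ} (ht : 0 ≤ t) :
    ∃ (c : EuclideanSpace ℝ (Fin n))
      (F : ℝ → EuclideanSpace ℝ (Fin n) →L[ℝ] EuclideanSpace ℝ (Fin n)),
      Continuous F ∧ ∀ u s, P.Admissible u → P.IsTrajectory u s →
        s t = c + ∫ τ in (0 : ℝ)..t, F τ (u τ) := by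
  choose ψ hψ hψeq using fun i : Fin n => P.exists_adjoint_solution ht (EuclideanSpace.single i 1)
  have hcont : Continuous fun τ => ∑ i, (innerSL ℝ (ψ i τ)).smulRight
      (EuclideanSpace.single i (1 : ℝ)) := by
    refine continuous_finsetSum _ fun i _ => ?_
    exact ((ContinuousLinearMap.smulRightL ℝ (EuclideanSpace ℝ (Fin n))
      (EuclideanSpace ℝ (Fin n))).flip (EuclideanSpace.single i (1 : ℝ))).continuous.comp
      ((innerSL ℝ).continuous.comp (hψ i))
  refine ⟨WithLp.toLp 2 fun i => inner ℝ (ψ i 0) P.s₀,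
    fun τ => ∑ i, (innerSL ℝ (ψ i τ)).smulRight (EuclideanSpace.single i (1 : ℝ)), hcont,
    fun u s hu hs => ?_⟩
  have hint : IntervalIntegrable (fun τ => (∑ i, (innerSL ℝ (ψ i τ)).smulRight
      (EuclideanSpace.single i (1 : ℝ))) (u τ)) volume 0 t := by
    exact (hu.intervalIntegrable ht).continuous_clm_apply hcont
  ext i
  have h := hψeq i u s hu hs
  rw [EuclideanSpace.inner_single_left] at h
  simp only [map_one, one_mul] at h
  rw [h, PiLp.add_apply]
  congr 1
  refine Eq.trans ?_ ((EuclideanSpace.proj (𝕜 := ℝ) i).intervalIntegral_comp_comm hint)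
  refine intervalIntegral.integral_congr fun τ _ => ?_
  simp [PiLp.single_apply]

end LinearTimeProblem
end

noncomputable section

/-! ### Halving a vector integral -/

section Halving

variable {ι : Type*}

/-- Functions with values in `[0, 1]` that halve the integrals of all `φ i`. -/
def halvingDensities (μ : Measure ℝ) (φ : ι → ℝ → ℝ) : Set (Lp ℝ 2 μ) :=
  {g | 0 ≤ᵐ[μ] g ∧ g ≤ᵐ[μ] 1 ∧ ∀ i, ∫ τ, g τ * φ i τ ∂μ = (∫ τ, φ i τ ∂μ) / 2}

/-- The element of `L²` that represents a weak functional. -/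
def weakDualRep (μ : Measure ℝ) : WeakDual ℝ (Lp ℝ 2 μ) →ₗ[ℝ] Lp ℝ 2 μ :=
  (InnerProductSpace.toDual ℝ (Lp ℝ 2 μ)).symm.toLinearEquiv.toLinearMap ∘ₗ
    (WeakDual.toStrongDual (𝕜 := ℝ) (E := Lp ℝ 2 μ)).toLinearMap

lemma inner_weakDualRep {μ : Measure ℝ} (l : WeakDual ℝ (Lp ℝ 2 μ)) (h : Lp ℝ 2 μ) :
    inner ℝ (weakDualRep μ l) h = l h := by
  change inner ℝ ((InnerProductSpace.toDual ℝ (Lp ℝ 2 μ)).symm (WeakDual.toStrongDual l)) h = _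
  rw [InnerProductSpace.toDual_symm_apply]
  rfl

lemma weakDualRep_bijective (μ : Measure ℝ) : Function.Bijective (weakDualRep μ) :=
  ((WeakDual.toStrongDual (𝕜 := ℝ) (E := Lp ℝ 2 μ)).trans
    (InnerProductSpace.toDual ℝ (Lp ℝ 2 μ)).symm.toLinearEquiv).bijective

/-- Densities with values in `[0, 1]` lie in a ball of `L²`, so Banach–Alaoglu leaves only weak-*
closedness to check. -/
lemma isCompact_halvingDensities {μ : Measure ℝ} [IsFiniteMeasure μ] {φ : ι → ℝ → ℝ}
    (hφ : ∀ i, MemLp (φ i) 2 μ) :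
    IsCompact (weakDualRep μ ⁻¹' halvingDensities μ φ) := by
  have hone : MemLp (fun _ : ℝ => (1 : ℝ)) 2 μ := memLp_const 1
  have hsub : weakDualRep μ ⁻¹' halvingDensities μ φ ⊆
      WeakDual.toStrongDual ⁻¹' Metric.closedBall 0 ‖hone.toLp‖ := by
    intro l hl
    have h1 : ‖weakDualRep μ l‖ = ‖WeakDual.toStrongDual l‖ :=
      (InnerProductSpace.toDual ℝ (Lp ℝ 2 μ)).symm.norm_map _
    rw [Set.mem_preimage, mem_closedBall_zero_iff, ← h1]
    refine Lp.norm_le_norm_of_ae_le ?_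
    filter_upwards [hl.1, hl.2.1, hone.coeFn_toLp] with τ h0 h1 h2
    rw [h2, Real.norm_of_nonneg h0]
    simpa using h1
  refine (WeakDual.isCompact_closedBall 0 ‖hone.toLp‖).of_isClosed_subset ?_ hsub
  -- The almost everywhere bounds are equivalent to bounds on the integrals over all measurable
  -- sets, and those are weak-* closed conditions.
  have hset : weakDualRep μ ⁻¹' halvingDensities μ φ =
      (⋂ s : {s : Set ℝ // MeasurableSet s}, {l : WeakDual ℝ (Lp ℝ 2 μ) |
        l (indicatorConstLp 2 s.2 (measure_ne_top μ s.1) (1 : ℝ)) ∈ Set.Icc 0 (μ.real s.1)}) ∩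
      ⋂ i, {l : WeakDual ℝ (Lp ℝ 2 μ) | l ((hφ i).toLp) = (∫ τ, φ i τ ∂μ) / 2} := by
    ext l
    set g := weakDualRep μ l with hg
    have hgi : Integrable g μ := (Lp.memLp g).integrable (by norm_num)
    have e1 : ∀ s (hs : MeasurableSet s), l (indicatorConstLp 2 hs (measure_ne_top μ s) (1 : ℝ)) =
        ∫ τ in s, g τ ∂μ := fun s hs => by
      rw [← inner_weakDualRep, real_inner_comm, L2.inner_indicatorConstLp_one]
    have e2 : ∀ i, l ((hφ i).toLp) = ∫ τ, g τ * φ i τ ∂μ := fun i => by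
      rw [← inner_weakDualRep, L2.inner_def]
      refine integral_congr_ae ?_
      filter_upwards [(hφ i).coeFn_toLp] with τ h
      rw [h]
      simp [hg, mul_comm]
    have e3 : ∀ s, ∫ τ in s, (1 : ℝ) ∂μ = μ.real s := fun s => by simp
    simp only [Set.mem_preimage, Set.mem_inter_iff, Set.mem_iInter, Set.mem_ofPred_eq, e2, e1,
      Subtype.forall]
    rw [← hg]
    constructor
    · rintro ⟨h0, h1, h2⟩
      refine ⟨fun s hs => ⟨setIntegral_nonneg_of_ae h0, ?_⟩, h2⟩
      rw [← e3 s]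
      exact setIntegral_mono_ae hgi.integrableOn (integrable_const _).integrableOn h1
    · rintro ⟨h, h2⟩
      refine ⟨ae_nonneg_of_forall_setIntegral_nonneg hgi fun s hs _ => (h s hs).1, ?_, h2⟩
      refine ae_le_of_forall_setIntegral_le hgi (integrable_const (1 : ℝ)) fun s hs _ => ?_
      refine (h s hs).2.trans_eq ?_
      exact (e3 s).symm
  rw [hset]
  refine IsClosed.inter (isClosed_iInter fun s => ?_) (isClosed_iInter fun i => ?_)
  · exact isClosed_Icc.preimage (WeakDual.eval_continuous _)
  · exact isClosed_eq (WeakDual.eval_continuous _) continuous_const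

/-- **Lyapunov's convexity theorem** at the midpoint: finitely many integrals over a bounded
interval are halved simultaneously by some measurable set. -/
theorem exists_measurableSet_halving [Finite ι] (T : ℝ) {φ : ι → ℝ → ℝ}
    (hφ : ∀ i, Measurable (φ i)) {C : ℝ} (hC : ∀ i τ, |φ i τ| ≤ C) :
    ∃ E, MeasurableSet E ∧
      ∀ i, ∫ τ in E ∩ Set.Ioc 0 T, φ i τ = (∫ τ in Set.Ioc 0 T, φ i τ) / 2 := by
  set μ : Measure ℝ := volume.restrict (Set.Ioc 0 T) with hμ
  have hbd : ∀ i, MemLp (φ i) ⊤ μ := fun i =>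
    memLp_top_of_bound (hφ i).aestronglyMeasurable C (ae_of_all _ fun τ => hC i τ)
  have hφ2 : ∀ i, MemLp (φ i) 2 μ := fun i => (hbd i).mono_exponent le_top
  have hne : (weakDualRep μ ⁻¹' halvingDensities μ φ).Nonempty := by
    have hhalf : MemLp (fun _ : ℝ => (1 / 2 : ℝ)) 2 μ := memLp_const _
    obtain ⟨l, hl⟩ := (weakDualRep_bijective μ).2 hhalf.toLp
    refine ⟨l, ?_⟩
    rw [Set.mem_preimage, hl]
    refine ⟨?_, ?_, fun i => ?_⟩
    · filter_upwards [hhalf.coeFn_toLp] with τ h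
      rw [h]; norm_num
    · filter_upwards [hhalf.coeFn_toLp] with τ h
      rw [h]; norm_num
    · rw [div_eq_inv_mul (∫ τ, φ i τ ∂μ), ← integral_const_mul]
      refine integral_congr_ae ?_
      filter_upwards [hhalf.coeFn_toLp] with τ h
      rw [h]; norm_num
  have : LocallyConvexSpace ℝ (WeakDual ℝ (Lp ℝ 2 μ)) :=
    inferInstanceAs (LocallyConvexSpace ℝ (WeakBilin (topDualPairing ℝ (Lp ℝ 2 μ))))
  obtain ⟨l, hl⟩ := (isCompact_halvingDensities hφ2).extremePoints_nonempty hne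
  set g := weakDualRep μ l with hg
  obtain ⟨hlK, hlext⟩ := mem_extremePoints.1 hl
  obtain ⟨h0, h1, h2⟩ : g ∈ halvingDensities μ φ := hlK
  have hgm : StronglyMeasurable g := Lp.stronglyMeasurable g
  have hgφ : ∀ i, Integrable (fun τ => g τ * φ i τ) μ := fun i =>
    (Lp.memLp g).integrable_mul (hφ2 i)
  -- the extreme density takes only the values `0` and `1`
  have hA : ∀ k : ℕ, μ {τ | g τ ∈ Set.Icc (1 / ((k : ℝ) + 1)) (1 - 1 / ((k : ℝ) + 1))} = 0 := by
    intro k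
    set ε : ℝ := 1 / ((k : ℝ) + 1) with hε
    have hε0 : 0 < ε := by positivity
    set A := {τ | g τ ∈ Set.Icc ε (1 - ε)} with hAdef
    have hAm : MeasurableSet A := hgm.measurable measurableSet_Icc
    have hQb : ∀ Q : Polynomial ℝ, ∃ M, 0 < M ∧ ∀ τ ∈ Set.Ioc 0 T, |Q.eval τ| ≤ M := fun Q => by
      obtain ⟨M, hM⟩ := (isCompact_Icc (a := (0 : ℝ)) (b := T)).exists_bound_of_continuousOn
        Q.continuous.continuousOn
      exact ⟨max M 1, by positivity, fun τ hτ =>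
        (hM τ (Set.Ioc_subset_Icc_self hτ)).trans (le_max_left _ _)⟩
    have hQL : ∀ Q : Polynomial ℝ, MemLp (A.indicator fun τ => Q.eval τ) ⊤ μ := fun Q => by
      obtain ⟨M, hM0, hM⟩ := hQb Q
      refine memLp_top_of_bound (Q.continuous.measurable.indicator hAm).aestronglyMeasurable M ?_
      filter_upwards [ae_restrict_mem measurableSet_Ioc] with τ hτ
      by_cases h : τ ∈ A
      · rw [Set.indicator_of_mem h]; exact hM τ hτ
      · rw [Set.indicator_of_notMem h]; simpa using hM0.le
    have hQφ : ∀ (Q : Polynomial ℝ) i,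
        Integrable (fun τ => A.indicator (fun τ => Q.eval τ) τ * φ i τ) μ := fun Q i =>
      ((hQL Q).mono_exponent le_top : MemLp _ 2 μ).integrable_mul (hφ2 i)
    let S : Polynomial ℝ →ₗ[ℝ] (ι → ℝ) :=
      { toFun := fun Q i => ∫ τ, A.indicator (fun τ => Q.eval τ) τ * φ i τ ∂μ
        map_add' := fun Q R => by
          ext i
          simp only [Pi.add_apply]
          rw [← integral_add (hQφ Q i) (hQφ R i)]
          refine integral_congr_ae (ae_of_all _ fun τ => ?_)
          by_cases h : τ ∈ A <;> simp [h, add_mul]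
        map_smul' := fun c Q => by
          ext i
          simp only [Pi.smul_apply, smul_eq_mul, RingHom.id_apply]
          rw [← integral_const_mul]
          refine integral_congr_ae (ae_of_all _ fun τ => ?_)
          by_cases h : τ ∈ A <;> simp [h, mul_assoc] }
    -- Polynomials form an infinite-dimensional space and `ι → ℝ` a finite-dimensional one, so some
    -- nonzero `Q`, cut off to `A`, has zero integral against every `φ i`.
    have hker : ¬ Function.Injective S := fun hinj =>
      Polynomial.not_finite (R := ℝ) (Module.Finite.of_injective S hinj)
    obtain ⟨Q, hSQ, hQ0⟩ : ∃ Q, S Q = 0 ∧ Q ≠ 0 := by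
      by_contra! hcon
      exact hker ((injective_iff_map_eq_zero S).2 hcon)
    obtain ⟨M, hM0, hM⟩ := hQb Q
    have hQ2 : MemLp (A.indicator fun τ => Q.eval τ) 2 μ := (hQL Q).mono_exponent le_top
    -- On `A` the density keeps distance `ε` from `0` and `1`, and `|Q| ≤ M`, so both signs of the
    -- perturbation are allowed. Extremality then forces `Q = 0` almost everywhere on `A`, and a
    -- nonzero polynomial has only finitely many roots.
    have hmem : ∀ c : ℝ, |c| = ε / M → g + c • hQ2.toLp ∈ halvingDensities μ φ := by
      intro c hc
      have hco : ∀ᵐ τ ∂μ, (g + c • hQ2.toLp : Lp ℝ 2 μ) τ =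
          g τ + c * A.indicator (fun τ => Q.eval τ) τ := by
        filter_upwards [Lp.coeFn_add g (c • hQ2.toLp), Lp.coeFn_smul c hQ2.toLp,
          hQ2.coeFn_toLp] with τ e1 e2 e3
        rw [e1, Pi.add_apply, e2, Pi.smul_apply, e3, smul_eq_mul]
      have hbound : ∀ᵐ τ ∂μ, (g + c • hQ2.toLp : Lp ℝ 2 μ) τ ∈ Set.Icc (0 : ℝ) 1 := by
        filter_upwards [hco, h0, h1, ae_restrict_mem measurableSet_Ioc] with τ e b0 b1 hτ
        rw [e]
        by_cases h : τ ∈ A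
        · rw [Set.indicator_of_mem h]
          have hb : |c * Q.eval τ| ≤ ε := by
            rw [abs_mul, hc]
            calc ε / M * |Q.eval τ| ≤ ε / M * M := by gcongr; exact hM τ hτ
              _ = ε := by field_simp
          have := abs_le.1 hb
          have hh := h
          rw [hAdef, Set.mem_ofPred_eq, Set.mem_Icc] at hh
          constructor <;> linarith [hh.1, hh.2, this.1, this.2]
        · rw [Set.indicator_of_notMem h, mul_zero, add_zero]
          exact ⟨b0, b1⟩
      refine ⟨hbound.mono fun τ h => h.1, hbound.mono fun τ h => h.2, fun i => ?_⟩
      have hS : ∫ τ, A.indicator (fun τ => Q.eval τ) τ * φ i τ ∂μ = 0 := congrFun hSQ i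
      rw [← h2 i]
      calc ∫ τ, (g + c • hQ2.toLp : Lp ℝ 2 μ) τ * φ i τ ∂μ
          = ∫ τ, (g τ * φ i τ + c * (A.indicator (fun τ => Q.eval τ) τ * φ i τ)) ∂μ := by
            refine integral_congr_ae ?_
            filter_upwards [hco] with τ e
            rw [e]; ring
        _ = _ := by
            rw [integral_add (hgφ i) ((hQφ Q i).const_mul c), integral_const_mul, hS]; simp
    obtain ⟨d, hd⟩ := (weakDualRep_bijective μ).2 ((ε / M) • hQ2.toLp)
    have hεM : 0 < ε / M := by positivity
    have hp : l + d ∈ weakDualRep μ ⁻¹' halvingDensities μ φ := by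
      rw [Set.mem_preimage, map_add, hd]
      exact hmem _ (abs_of_pos hεM)
    have hm : l - d ∈ weakDualRep μ ⁻¹' halvingDensities μ φ := by
      rw [Set.mem_preimage, map_sub, hd, sub_eq_add_neg, ← neg_smul]
      exact hmem _ (by rw [abs_neg, abs_of_pos hεM])
    have hseg : l ∈ openSegment ℝ (l + d) (l - d) :=
      ⟨1 / 2, 1 / 2, by norm_num, by norm_num, by norm_num, by module⟩
    have hd0 : d = 0 := by simpa using (hlext _ hp _ hm hseg).1
    rw [hd0, map_zero, eq_comm, smul_eq_zero_iff_right hεM.ne'] at hd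
    have hz : ∀ᵐ τ ∂μ, τ ∈ A → Q.IsRoot τ := by
      have hz0 := Lp.coeFn_zero ℝ 2 μ
      rw [← hd] at hz0
      filter_upwards [hQ2.coeFn_toLp, hz0] with τ e1 e2 hτ
      rw [e2, Set.indicator_of_mem hτ] at e1
      exact e1.symm
    have hfin : μ {τ | Q.IsRoot τ} = 0 := by
      have hf : {τ | Q.IsRoot τ}.Finite := by
        refine Q.roots.toFinset.finite_toSet.subset fun τ hτ => ?_
        simpa [hQ0] using hτ
      exact hf.measure_zero _
    refine measure_mono_null_ae ?_ hfin
    exact hz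
  have h01 : ∀ᵐ τ ∂μ, g τ = 0 ∨ g τ = 1 := by
    have hall : ∀ᵐ τ ∂μ, ∀ k : ℕ,
        g τ ∉ Set.Icc (1 / ((k : ℝ) + 1)) (1 - 1 / ((k : ℝ) + 1)) :=
      ae_all_iff.2 fun k => measure_eq_zero_iff_ae_notMem.1 (hA k)
    filter_upwards [hall, h0, h1] with τ h b0 b1
    by_contra! hcon
    have p0 : 0 < g τ := lt_of_le_of_ne b0 (Ne.symm hcon.1)
    have p1 : g τ < 1 := lt_of_le_of_ne b1 hcon.2
    obtain ⟨k, hk⟩ := exists_nat_one_div_lt (lt_min p0 (sub_pos.2 p1))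
    have := lt_min_iff.1 hk
    exact h k ⟨this.1.le, by linarith [this.2]⟩
  have hE : MeasurableSet {τ | g τ = 1} := hgm.measurable (measurableSet_singleton 1)
  refine ⟨{τ | g τ = 1}, hE, fun i => ?_⟩
  rw [← h2 i, ← Measure.restrict_restrict hE, ← hμ, ← integral_indicator hE]
  refine integral_congr_ae ?_
  filter_upwards [h01] with τ h
  rcases h with h | h <;> simp [Set.indicator, h]

end Halving

end

noncomputable section

/-! ### Measurable selection of maximizers -/

variable {n : ℕ}

/-- `x` maximizes the linear functional `v` over `M`. -/
def IsArgmax (M : Set (EuclideanSpace ℝ (Fin n))) (v x : EuclideanSpace ℝ (Fin n)) : Prop :=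
  x ∈ M ∧ ∀ y ∈ M, inner ℝ v y ≤ inner ℝ v x

lemma IsCompact.exists_isArgmax {M : Set (EuclideanSpace ℝ (Fin n))} (hM : IsCompact M)
    (hne : M.Nonempty) (v : EuclideanSpace ℝ (Fin n)) : ∃ x, IsArgmax M v x := by
  obtain ⟨x, hx, h⟩ := hM.exists_isMaxOn hne
    (continuous_const.inner continuous_id : Continuous fun y => inner ℝ v y).continuousOn
  exact ⟨x, hx, h⟩

lemma isClosed_setOf_isArgmax {M : Set (EuclideanSpace ℝ (Fin n))} (hM : IsClosed M) :
    IsClosed {z : EuclideanSpace ℝ (Fin n) × EuclideanSpace ℝ (Fin n) | IsArgmax M z.1 z.2} := by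
  have : {z : EuclideanSpace ℝ (Fin n) × EuclideanSpace ℝ (Fin n) | IsArgmax M z.1 z.2} =
      Prod.snd ⁻¹' M ∩ ⋂ y ∈ M, {z | inner ℝ z.1 y ≤ inner ℝ z.1 z.2} := by
    ext z
    simp [IsArgmax]
  rw [this]
  exact (hM.preimage continuous_snd).inter (isClosed_biInter fun y _ =>
    isClosed_le (by fun_prop) (by fun_prop))

/-- A compact set has a Borel measurable contact map. -/
theorem IsCompact.exists_measurable_isArgmax {M : Set (EuclideanSpace ℝ (Fin n))}
    (hM : IsCompact M) (hne : M.Nonempty) :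
    ∃ σ : EuclideanSpace ℝ (Fin n) → EuclideanSpace ℝ (Fin n),
      Measurable σ ∧ ∀ v, IsArgmax M v (σ v) := by
  have : Nonempty M := hne.to_subtype
  have : CompactSpace M := isCompact_iff_compactSpace.1 hM
  obtain ⟨f, hf, hfs⟩ := exists_nat_bool_continuous_surjective_of_compact M
  set ψ : cantorSet → EuclideanSpace ℝ (Fin n) :=
    fun c => f (cantorSetHomeomorphNatToBool c) with hψdef
  have hψ : Continuous ψ := by fun_prop
  have hψs : ∀ x ∈ M, ∃ c, ψ c = x := fun x hx => by
    obtain ⟨b, hb⟩ := hfs ⟨x, hx⟩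
    exact ⟨cantorSetHomeomorphNatToBool.symm b, by simp [hψdef, hb]⟩
  have : CompactSpace cantorSet := isCompact_iff_compactSpace.1 isCompact_cantorSet
  have hcl : IsClosed {z : EuclideanSpace ℝ (Fin n) × cantorSet | IsArgmax M z.1 (ψ z.2)} :=
    (isClosed_setOf_isArgmax hM.isClosed).preimage
      (continuous_fst.prodMk (hψ.comp continuous_snd))
  -- The Cantor set maps onto `M` and is linearly ordered, so the least parameter of a maximizer is
  -- a canonical choice.
  have hmin : ∀ v, ∃ c, IsArgmax M v (ψ c) ∧ ∀ d, IsArgmax M v (ψ d) → c ≤ d := fun v => by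
    have hv : IsCompact {c | IsArgmax M v (ψ c)} :=
      (hcl.preimage (continuous_const.prodMk continuous_id :
        Continuous fun c : cantorSet => (v, c))).isCompact
    obtain ⟨x, hx⟩ := hM.exists_isArgmax hne v
    obtain ⟨c, rfl⟩ := hψs x hx.1
    obtain ⟨d, hd⟩ := hv.exists_isLeast ⟨c, hx⟩
    exact ⟨d, hd.1, fun e he => hd.2 he⟩
  choose m hm hmle using hmin
  refine ⟨fun v => ψ (m v), hψ.measurable.comp ?_, hm⟩
  have hmm : Measurable fun v => (m v : ℝ) := by
    refine measurable_of_Iic fun a => ?_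
    -- By minimality, `m v ≤ a` as soon as any maximizer has a parameter at most `a`. The sublevel
    -- set is therefore the projection of a closed set along a compact factor, hence closed.
    have e : (fun v => (m v : ℝ)) ⁻¹' Set.Iic a = Prod.fst ''
        ({z : EuclideanSpace ℝ (Fin n) × cantorSet | IsArgmax M z.1 (ψ z.2)} ∩
          {z | (z.2 : ℝ) ≤ a}) := by
      ext v
      constructor
      · exact fun h => ⟨(v, m v), ⟨hm v, h⟩, rfl⟩
      · rintro ⟨⟨w, c⟩, ⟨h1, h2⟩, rfl⟩
        exact (Subtype.coe_le_coe.2 (hmle w c h1)).trans h2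
    rw [e]
    exact (isClosedMap_fst_of_compactSpace _ (hcl.inter
      (isClosed_le (by fun_prop) continuous_const))).measurableSet
  exact hmm.subtype_mk

end

noncomputable section

/-! ### Contact points of the reachable set -/

variable {n : ℕ}

lemma isArgmax_contactPoint {M : Set (EuclideanSpace ℝ (Fin n))} {p : EuclideanSpace ℝ (Fin n)}
    (h : ∃ x, IsArgmax M p x) : IsArgmax M p (contactPoint M p) :=
  Classical.epsilon_spec h

lemma IsArgmax.mem_frontier {M : Set (EuclideanSpace ℝ (Fin n))} {p x : EuclideanSpace ℝ (Fin n)}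
    (h : IsArgmax M p x) (hp : p ≠ 0) : x ∈ frontier M := by
  refine ⟨subset_closure h.1, fun hx => ?_⟩
  have hc : Tendsto (fun ε : ℝ => x + ε • p) (𝓝[>] 0) (𝓝 x) := by
    have : Continuous fun ε : ℝ => x + ε • p := by fun_prop
    simpa using (this.tendsto 0).mono_left nhdsWithin_le_nhds
  obtain ⟨ε, hε, hε0⟩ := ((hc.eventually (mem_interior_iff_mem_nhds.1 hx)).and
    self_mem_nhdsWithin).exists
  have h1 := h.2 _ hε
  rw [inner_add_right, inner_smul_right] at h1
  have : 0 < ε * inner ℝ p p := mul_pos hε0 (real_inner_self_pos.2 hp)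
  linarith

/-- The directions for which the contact face of `M` meets `B` form a closed set. -/
lemma isClosed_setOf_exists_isArgmax {M B : Set (EuclideanSpace ℝ (Fin n))} (hM : IsCompact M)
    (hB : IsClosed B) : IsClosed {v | ∃ x ∈ B, IsArgmax M v x} := by
  have : CompactSpace M := isCompact_iff_compactSpace.1 hM
  have hcl : IsClosed {z : EuclideanSpace ℝ (Fin n) × M |
      IsArgmax M z.1 z.2 ∧ (z.2 : EuclideanSpace ℝ (Fin n)) ∈ B} :=
    ((isClosed_setOf_isArgmax hM.isClosed).preimage
      (continuous_fst.prodMk (continuous_subtype_val.comp continuous_snd))).inter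
      (hB.preimage (continuous_subtype_val.comp continuous_snd))
  convert isClosedMap_fst_of_compactSpace _ hcl using 1
  ext v
  constructor
  · rintro ⟨x, hxB, hx⟩
    exact ⟨(v, ⟨x, hx.1⟩), ⟨hx, hxB⟩, rfl⟩
  · rintro ⟨⟨w, x⟩, ⟨h1, h2⟩, rfl⟩
    exact ⟨x, h2, h1⟩

/-- A contact map that selects its values in `B` whenever the contact face meets `B`. -/
lemma IsCompact.exists_measurable_isArgmax_mem {M B : Set (EuclideanSpace ℝ (Fin n))}
    (hM : IsCompact M) (hne : M.Nonempty) (hB : IsClosed B) :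
    ∃ σ : EuclideanSpace ℝ (Fin n) → EuclideanSpace ℝ (Fin n), Measurable σ ∧
      (∀ v, IsArgmax M v (σ v)) ∧ ∀ v, (∃ x ∈ B, IsArgmax M v x) → σ v ∈ B := by
  classical
  obtain ⟨σ, hσm, hσ⟩ := hM.exists_measurable_isArgmax hne
  by_cases hMB : (M ∩ B).Nonempty
  -- Where the contact face of `M` meets `B`, maximizers over `M ∩ B` are maximizers over `M`.
  · obtain ⟨ρ, hρm, hρ⟩ := (hM.inter_right hB).exists_measurable_isArgmax hMB
    have hS := (isClosed_setOf_exists_isArgmax hM hB).measurableSet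
    refine ⟨Set.piecewise {v | ∃ x ∈ B, IsArgmax M v x} ρ σ, hρm.piecewise hS hσm,
      fun v => ?_, fun v hv => ?_⟩
    · by_cases hv : v ∈ {v | ∃ x ∈ B, IsArgmax M v x}
      · rw [Set.piecewise_eq_of_mem _ _ _ hv]
        obtain ⟨x, hxB, hx⟩ := hv
        exact ⟨(hρ v).1.1, fun y hy => (hx.2 y hy).trans ((hρ v).2 x ⟨hx.1, hxB⟩)⟩
      · rw [Set.piecewise_eq_of_notMem _ _ _ hv]
        exact hσ v
    · have hv' : v ∈ {v | ∃ x ∈ B, IsArgmax M v x} := hv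
      rw [Set.piecewise_eq_of_mem _ _ _ hv']
      exact (hρ v).1.2
  · exact ⟨σ, hσm, hσ, fun v ⟨x, hxB, hx⟩ => absurd ⟨x, hx.1, hxB⟩ hMB⟩

lemma intervalIntegral_eq_of_coord {f g : ℝ → EuclideanSpace ℝ (Fin n)} {a b : ℝ}
    (hf : IntervalIntegrable f volume a b) (hg : IntervalIntegrable g volume a b)
    (h : ∀ i, ∫ τ in a..b, (f τ - g τ) i = 0) : ∫ τ in a..b, f τ = ∫ τ in a..b, g τ := by
  rw [← sub_eq_zero, ← intervalIntegral.integral_sub hf hg]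
  ext i
  exact ((EuclideanSpace.proj (𝕜 := ℝ) i).intervalIntegral_comp_comm (hf.sub hg)).symm.trans (h i)

/-- The costate `τ ↦ F(τ)ᵀ p` of an endpoint kernel `F`. -/
def costate (F : ℝ → EuclideanSpace ℝ (Fin n) →L[ℝ] EuclideanSpace ℝ (Fin n))
    (p : EuclideanSpace ℝ (Fin n)) (τ : ℝ) : EuclideanSpace ℝ (Fin n) :=
  ContinuousLinearMap.adjoint (F τ) p

section Costate

variable {F : ℝ → EuclideanSpace ℝ (Fin n) →L[ℝ] EuclideanSpace ℝ (Fin n)}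

lemma inner_costate (p : EuclideanSpace ℝ (Fin n)) (τ : ℝ) (v : EuclideanSpace ℝ (Fin n)) :
    inner ℝ (costate F p τ) v = inner ℝ p (F τ v) :=
  ContinuousLinearMap.adjoint_inner_left _ _ _

lemma continuous_costate (hF : Continuous F) (p : EuclideanSpace ℝ (Fin n)) :
    Continuous (costate F p) :=
  (ContinuousLinearMap.adjoint.continuous.comp hF).clm_apply continuous_const

lemma continuous_costate_left (τ : ℝ) : Continuous fun p => costate F p τ :=
  (ContinuousLinearMap.adjoint (F τ)).continuous

end Costate

namespace LinearTimeProblem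

variable {P : LinearTimeProblem n} {t : ℝ} {c : EuclideanSpace ℝ (Fin n)}
  {F : ℝ → EuclideanSpace ℝ (Fin n) →L[ℝ] EuclideanSpace ℝ (Fin n)}
  {p : EuclideanSpace ℝ (Fin n)}

/-- `c` and `F` represent the endpoints at time `t` of all trajectories. -/
def IsEndpointKernel (P : LinearTimeProblem n) (t : ℝ) (c : EuclideanSpace ℝ (Fin n))
    (F : ℝ → EuclideanSpace ℝ (Fin n) →L[ℝ] EuclideanSpace ℝ (Fin n)) : Prop :=
  Continuous F ∧ ∀ u s, P.Admissible u → P.IsTrajectory u s →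
    s t = c + ∫ τ in (0 : ℝ)..t, F τ (u τ)

lemma IsEndpointKernel.mem_reachableSet_iff (hK : P.IsEndpointKernel t c F)
    {x : EuclideanSpace ℝ (Fin n)} :
    x ∈ P.reachableSet t ↔ ∃ u, P.Admissible u ∧ x = c + ∫ τ in (0 : ℝ)..t, F τ (u τ) := by
  constructor
  · rintro ⟨u, s, hu, hs, rfl⟩
    exact ⟨u, hu, hK.2 u s hu hs⟩
  · rintro ⟨u, hu, rfl⟩
    obtain ⟨s, hs⟩ := hu.exists_isTrajectory
    exact ⟨u, s, hu, hs, hK.2 u s hu hs⟩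

lemma Admissible.intervalIntegrable_kernel {u : ℝ → EuclideanSpace ℝ (Fin n)}
    (hu : P.Admissible u) (ht : 0 ≤ t) (hF : Continuous F) :
    IntervalIntegrable (fun τ => F τ (u τ)) volume 0 t :=
  (hu.intervalIntegrable ht).continuous_clm_apply hF

lemma Admissible.intervalIntegrable_inner_costate {u : ℝ → EuclideanSpace ℝ (Fin n)}
    (hu : P.Admissible u) (ht : 0 ≤ t) (hF : Continuous F) (p : EuclideanSpace ℝ (Fin n)) :
    IntervalIntegrable (fun τ => inner ℝ (costate F p τ) (u τ)) volume 0 t := by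
  have h := hu.intervalIntegrable_kernel ht hF
  simp only [inner_costate]
  exact ⟨(innerSL ℝ p).integrable_comp h.1, (innerSL ℝ p).integrable_comp h.2⟩

lemma Admissible.inner_endpoint {u : ℝ → EuclideanSpace ℝ (Fin n)}
    (hu : P.Admissible u) (ht : 0 ≤ t) (hF : Continuous F) (p : EuclideanSpace ℝ (Fin n)) :
    inner ℝ p (c + ∫ τ in (0 : ℝ)..t, F τ (u τ)) =
      inner ℝ p c + ∫ τ in (0 : ℝ)..t, inner ℝ (costate F p τ) (u τ) := by
  rw [inner_add_right]
  congr 1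
  simp only [inner_costate]
  exact ((innerSL ℝ p).intervalIntegral_comp_comm (hu.intervalIntegrable_kernel ht hF)).symm

lemma admissible_of_isArgmax {w : ℝ → EuclideanSpace ℝ (Fin n)} (hw : Measurable w)
    (h : ∀ τ, IsArgmax P.U (costate F p τ) (w τ)) : P.Admissible w :=
  ⟨hw, fun τ _ => (h τ).1⟩

/-- A control that satisfies the pointwise maximum condition reaches a contact point. -/
lemma IsEndpointKernel.isArgmax_endpoint (hK : P.IsEndpointKernel t c F) (ht : 0 ≤ t)
    {w : ℝ → EuclideanSpace ℝ (Fin n)} (hw : Measurable w)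
    (h : ∀ τ, IsArgmax P.U (costate F p τ) (w τ)) :
    IsArgmax (P.reachableSet t) p (c + ∫ τ in (0 : ℝ)..t, F τ (w τ)) := by
  have hwa := admissible_of_isArgmax hw h
  refine ⟨hK.mem_reachableSet_iff.2 ⟨w, hwa, rfl⟩, fun y hy => ?_⟩
  obtain ⟨u, hu, rfl⟩ := hK.mem_reachableSet_iff.1 hy
  rw [hu.inner_endpoint ht hK.1, hwa.inner_endpoint ht hK.1]
  gcongr
  refine intervalIntegral.integral_mono_on ht (hu.intervalIntegrable_inner_costate ht hK.1 p)
    (hwa.intervalIntegrable_inner_costate ht hK.1 p) fun τ hτ => (h τ).2 _ (hu.2 τ hτ.1)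

/-- Under normality, two controls that satisfy the pointwise maximum condition agree. -/
lemma IsEndpointKernel.ae_eq_of_isArgmax (hK : P.IsEndpointKernel t c F) (hN : P.Normality)
    (ht : 0 ≤ t) (hp : p ≠ 0) {u₁ u₂ : ℝ → EuclideanSpace ℝ (Fin n)}
    (hu₁ : Measurable u₁) (hu₂ : Measurable u₂)
    (h₁ : ∀ τ, IsArgmax P.U (costate F p τ) (u₁ τ))
    (h₂ : ∀ τ, IsArgmax P.U (costate F p τ) (u₂ τ)) :
    ∀ᵐ τ ∂(volume.restrict (Set.Icc 0 t)), u₁ τ = u₂ τ := by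
  classical
  have hF := hK.1
  obtain ⟨B, hB0, hB⟩ := P.isCompact_U.isBounded.exists_pos_norm_le
  obtain ⟨C, hC⟩ := (isCompact_Icc (a := (0 : ℝ)) (b := t)).exists_bound_of_continuousOn
    hF.continuousOn
  -- The cutoff to `[0, t]` provides the global bound that the halving theorem asks for.
  set φ : Fin n → ℝ → ℝ := fun i =>
    (Set.Icc 0 t).indicator fun τ => (F τ (u₁ τ - u₂ τ)) i with hφ
  have hC0 : 0 ≤ C := (norm_nonneg _).trans (hC 0 ⟨le_rfl, ht⟩)
  have hφm : ∀ i, Measurable (φ i) := fun i => by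
    refine Measurable.indicator ?_ measurableSet_Icc
    have h1 : Measurable fun τ => F τ (u₁ τ - u₂ τ) :=
      (isBoundedBilinearMap_apply (𝕜 := ℝ) (E := EuclideanSpace ℝ (Fin n))
        (F := EuclideanSpace ℝ (Fin n))).continuous.measurable.comp
        (hF.measurable.prodMk (hu₁.sub hu₂))
    exact (EuclideanSpace.proj (𝕜 := ℝ) i).continuous.measurable.comp h1
  have hφC : ∀ i τ, |φ i τ| ≤ C * (B + B) := fun i τ => by
    by_cases hτ : τ ∈ Set.Icc 0 t
    · rw [hφ]
      simp only [Set.indicator_of_mem hτ]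
      calc |(F τ (u₁ τ - u₂ τ)) i| ≤ ‖F τ (u₁ τ - u₂ τ)‖ := by
              rw [← Real.norm_eq_abs]; exact PiLp.norm_apply_le _ i
        _ ≤ ‖F τ‖ * ‖u₁ τ - u₂ τ‖ := (F τ).le_opNorm _
        _ ≤ C * (B + B) := by
          gcongr
          · exact hC τ hτ
          · exact (norm_sub_le _ _).trans (add_le_add (hB _ (h₁ τ).1) (hB _ (h₂ τ).1))
    · rw [hφ]
      simp only [Set.indicator_of_notMem hτ, abs_zero]
      positivity
  obtain ⟨E, hE, hEφ⟩ := exists_measurableSet_halving t hφm hφC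
  set v₁ := E.piecewise u₁ u₂ with hv₁
  set v₂ := E.piecewise u₂ u₁ with hv₂
  have hm₁ : Measurable v₁ := hu₁.piecewise hE hu₂
  have hm₂ : Measurable v₂ := hu₂.piecewise hE hu₁
  have ha₁ : ∀ τ, IsArgmax P.U (costate F p τ) (v₁ τ) := fun τ => by
    by_cases hτ : τ ∈ E
    · rw [hv₁, Set.piecewise_eq_of_mem _ _ _ hτ]; exact h₁ τ
    · rw [hv₁, Set.piecewise_eq_of_notMem _ _ _ hτ]; exact h₂ τ
  have ha₂ : ∀ τ, IsArgmax P.U (costate F p τ) (v₂ τ) := fun τ => by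
    by_cases hτ : τ ∈ E
    · rw [hv₂, Set.piecewise_eq_of_mem _ _ _ hτ]; exact h₂ τ
    · rw [hv₂, Set.piecewise_eq_of_notMem _ _ _ hτ]; exact h₁ τ
  have hA₁ := admissible_of_isArgmax hm₁ ha₁
  have hA₂ := admissible_of_isArgmax hm₂ ha₂
  have heq : ∫ τ in (0 : ℝ)..t, F τ (v₁ τ) = ∫ τ in (0 : ℝ)..t, F τ (v₂ τ) := by
    refine intervalIntegral_eq_of_coord (hA₁.intervalIntegrable_kernel ht hF)
      (hA₂.intervalIntegrable_kernel ht hF) fun i => ?_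
    have hφi : IntegrableOn (φ i) (Set.Ioc 0 t) := by
      refine Integrable.of_bound (hφm i).aestronglyMeasurable (C * (B + B)) ?_
      exact ae_of_all _ fun τ => hφC i τ
    -- Swapping on `E` gives `v₁ - v₂ = (2 · 1_E - 1)(u₁ - u₂)`, whose integral against `F` vanishes
    -- because `E` halves it.
    have e1 : ∫ τ in Set.Ioc 0 t, (F τ (v₁ τ) - F τ (v₂ τ)) i =
        ∫ τ in Set.Ioc 0 t, (2 * E.indicator (φ i) τ - φ i τ) := by
      refine setIntegral_congr_fun measurableSet_Ioc fun τ hτ => ?_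
      have hτ' := Set.Ioc_subset_Icc_self hτ
      by_cases hτE : τ ∈ E
      · simp only [hv₁, hv₂, Set.piecewise_eq_of_mem _ _ _ hτE, Set.indicator_of_mem hτE, hφ,
          Set.indicator_of_mem hτ', map_sub, PiLp.sub_apply]
        ring
      · simp only [hv₁, hv₂, Set.piecewise_eq_of_notMem _ _ _ hτE,
          Set.indicator_of_notMem hτE, hφ, Set.indicator_of_mem hτ', map_sub, PiLp.sub_apply]
        ring
    rw [intervalIntegral.integral_of_le ht, e1, integral_sub ((hφi.indicator hE).const_mul 2) hφi,
      integral_const_mul, integral_indicator hE, Measure.restrict_restrict hE, hEφ i]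
    ring
  obtain ⟨s₁, hs₁⟩ := hA₁.exists_isTrajectory
  obtain ⟨s₂, hs₂⟩ := hA₂.exists_isTrajectory
  have e₁ := hK.2 v₁ s₁ hA₁ hs₁
  have e₂ := hK.2 v₂ s₂ hA₂ hs₂
  have hfr : s₁ t ∈ frontier (P.reachableSet t) := by
    rw [e₁]
    exact (hK.isArgmax_endpoint ht hm₁ ha₁).mem_frontier hp
  have hae := hN t ht v₁ v₂ s₁ s₂ hA₁ hA₂ hs₁ hs₂ (by rw [e₁, e₂, heq]) hfr
  filter_upwards [hae] with τ hτ
  by_cases hτE : τ ∈ E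
  · rwa [hv₁, hv₂, Set.piecewise_eq_of_mem _ _ _ hτE, Set.piecewise_eq_of_mem _ _ _ hτE] at hτ
  · rw [hv₁, hv₂, Set.piecewise_eq_of_notMem _ _ _ hτE,
      Set.piecewise_eq_of_notMem _ _ _ hτE] at hτ
    exact hτ.symm

/-- Under normality, the pointwise maximum condition determines the control at almost all times. -/
lemma IsEndpointKernel.ae_isArgmax_unique (hK : P.IsEndpointKernel t c F) (hN : P.Normality)
    (ht : 0 ≤ t) (hp : p ≠ 0) :
    ∀ᵐ τ ∂(volume.restrict (Set.Icc 0 t)), ∀ x y, IsArgmax P.U (costate F p τ) x →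
      IsArgmax P.U (costate F p τ) y → x = y := by
  have hψ : Measurable (costate F p) := (continuous_costate hK.1 p).measurable
  set d := TopologicalSpace.denseSeq (EuclideanSpace ℝ (Fin n))
  -- A face with two points meets both a small ball around some `d j` and the outside of the ball of
  -- twice the radius. For each of these countably many pairs, one selection prefers the ball and
  -- another the outside; they agree almost everywhere, so the face cannot meet both there.
  have hall : ∀ᵐ τ ∂(volume.restrict (Set.Icc 0 t)), ∀ jk : ℕ × ℕ, ¬
      ((∃ x ∈ {x | dist x (d jk.1) ≤ 1 / ((jk.2 : ℝ) + 1)}, IsArgmax P.U (costate F p τ) x) ∧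
        ∃ x ∈ {x | 2 * (1 / ((jk.2 : ℝ) + 1)) ≤ dist x (d jk.1)},
          IsArgmax P.U (costate F p τ) x) := by
    refine ae_all_iff.2 fun jk => ?_
    have hr : 0 < 1 / ((jk.2 : ℝ) + 1) := by positivity
    obtain ⟨σ₁, hm₁, hσ₁, hB₁⟩ := P.isCompact_U.exists_measurable_isArgmax_mem P.nonempty_U
      (isClosed_le (f := fun x => dist x (d jk.1)) (g := fun _ => 1 / ((jk.2 : ℝ) + 1))
        (by fun_prop) (by fun_prop))
    obtain ⟨σ₂, hm₂, hσ₂, hB₂⟩ := P.isCompact_U.exists_measurable_isArgmax_mem P.nonempty_U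
      (isClosed_le (g := fun x => dist x (d jk.1)) (f := fun _ => 2 * (1 / ((jk.2 : ℝ) + 1)))
        (by fun_prop) (by fun_prop))
    filter_upwards [hK.ae_eq_of_isArgmax hN ht hp (hm₁.comp hψ) (hm₂.comp hψ)
      (fun τ => hσ₁ _) (fun τ => hσ₂ _)] with τ hτ
    rintro ⟨hx, hy⟩
    have b1 : dist (σ₁ (costate F p τ)) (d jk.1) ≤ 1 / ((jk.2 : ℝ) + 1) := hB₁ _ hx
    have b2 : 2 * (1 / ((jk.2 : ℝ) + 1)) ≤ dist (σ₂ (costate F p τ)) (d jk.1) := hB₂ _ hy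
    simp only [Function.comp_apply] at hτ
    rw [hτ] at b1
    linarith
  filter_upwards [hall] with τ h x y hx hy
  by_contra hne
  -- With radius `r < dist x y / 3` and `d j` within `r` of `x`, the point `y` is at distance more
  -- than `2 r` from `d j`.
  obtain ⟨k, hk⟩ := exists_nat_one_div_lt (show 0 < dist x y / 3 from by
    have := dist_pos.2 hne; positivity)
  obtain ⟨j, hj⟩ := (TopologicalSpace.denseRange_denseSeq
    (EuclideanSpace ℝ (Fin n))).exists_dist_lt x (show 0 < 1 / ((k : ℝ) + 1) by positivity)
  refine h (j, k) ⟨⟨x, hj.le, hx⟩, ⟨y, ?_, hy⟩⟩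
  have := dist_triangle x (d j) y
  rw [dist_comm (d j) y] at this
  change 2 * (1 / ((k : ℝ) + 1)) ≤ dist y (d j)
  change dist x (d j) < _ at hj
  linarith

/-- Under normality, contact points of the reachable set are unique. -/
lemma IsEndpointKernel.eq_endpoint_of_isArgmax (hK : P.IsEndpointKernel t c F) (hN : P.Normality)
    (ht : 0 ≤ t) (hp : p ≠ 0) {w : ℝ → EuclideanSpace ℝ (Fin n)} (hw : Measurable w)
    (h : ∀ τ, IsArgmax P.U (costate F p τ) (w τ)) {x : EuclideanSpace ℝ (Fin n)}
    (hx : IsArgmax (P.reachableSet t) p x) : x = c + ∫ τ in (0 : ℝ)..t, F τ (w τ) := by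
  have hwa := admissible_of_isArgmax hw h
  obtain ⟨u, hu, rfl⟩ := hK.mem_reachableSet_iff.1 hx.1
  have hle := hx.2 _ (hK.isArgmax_endpoint ht hw h).1
  rw [hu.inner_endpoint ht hK.1, hwa.inner_endpoint ht hK.1] at hle
  have iu := hu.intervalIntegrable_inner_costate ht hK.1 p
  have iw := hwa.intervalIntegrable_inner_costate ht hK.1 p
  -- The integrand is nonnegative with integral at most zero, so `u` satisfies the pointwise maximum
  -- condition almost everywhere.
  have hnn : ∀ τ ∈ Set.Ioc 0 t,
      0 ≤ inner ℝ (costate F p τ) (w τ) - inner ℝ (costate F p τ) (u τ) := fun τ hτ =>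
    sub_nonneg.2 ((h τ).2 _ (hu.2 τ hτ.1.le))
  have hz : ∫ τ in Set.Ioc 0 t,
      (inner ℝ (costate F p τ) (w τ) - inner ℝ (costate F p τ) (u τ)) = 0 := by
    refine le_antisymm ?_ (setIntegral_nonneg measurableSet_Ioc hnn)
    rw [← intervalIntegral.integral_of_le ht, intervalIntegral.integral_sub iw iu]
    linarith
  rw [setIntegral_eq_zero_iff_of_nonneg_ae ((ae_restrict_mem measurableSet_Ioc).mono hnn)
    (iw.sub iu).1] at hz
  congr 1
  rw [intervalIntegral.integral_of_le ht, intervalIntegral.integral_of_le ht]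
  refine integral_congr_ae ?_
  have huniq := hK.ae_isArgmax_unique hN ht hp
  rw [restrict_Ioc_eq_restrict_Icc] at hz ⊢
  filter_upwards [hz, huniq, ae_restrict_mem measurableSet_Icc] with τ h1 h2 hτ
  have : u τ = w τ := by
    refine h2 _ _ ⟨hu.2 τ hτ.1, fun y hy => ?_⟩ (h τ)
    have e : inner ℝ (costate F p τ) (w τ) - inner ℝ (costate F p τ) (u τ) = 0 := h1
    linarith [(h τ).2 y hy]
  rw [this]

/-- The maximizing control depends continuously on the direction at almost all times. -/
lemma tendsto_isArgmax {U : Set (EuclideanSpace ℝ (Fin n))} (hU : IsCompact U)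
    {α : Type*} {l : Filter α} {v : α → EuclideanSpace ℝ (Fin n)} {v₀ : EuclideanSpace ℝ (Fin n)}
    (hv : Tendsto v l (𝓝 v₀)) {x : α → EuclideanSpace ℝ (Fin n)} {x₀ : EuclideanSpace ℝ (Fin n)}
    (hx : ∀ᶠ a in l, IsArgmax U (v a) (x a)) (huniq : ∀ y, IsArgmax U v₀ y → y = x₀) :
    Tendsto x l (𝓝 x₀) := by
  refine hU.tendsto_nhds_of_unique_mapClusterPt (hx.mono fun a h => h.1) fun y _ hcl => huniq y ?_
  obtain ⟨f, hf, hfy⟩ := mapClusterPt_iff_ultrafilter.1 hcl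
  exact (isClosed_setOf_isArgmax hU.isClosed).mem_of_tendsto ((hv.mono_left hf).prodMk_nhds hfy)
    (hf hx)

variable (P) in
-- The maximum over `R(t)` is attained by a measurable pointwise maximizing control, without
-- compactness of `R(t)`. This includes `p = 0`, where any reachable point qualifies.
lemma isArgmax_contactR (ht : 0 ≤ t) (p : EuclideanSpace ℝ (Fin n)) :
    IsArgmax (P.reachableSet t) p (P.contactR t p) := by
  obtain ⟨c, F, hK⟩ := P.exists_endpoint_kernel ht
  obtain ⟨σ, hσm, hσ⟩ := P.isCompact_U.exists_measurable_isArgmax P.nonempty_U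
  exact isArgmax_contactPoint ⟨_, IsEndpointKernel.isArgmax_endpoint hK ht
    (hσm.comp (continuous_costate hK.1 p).measurable) fun τ => hσ _⟩

/-- Under normality, the contact function of the reachable set is continuous. -/
theorem continuousOn_contactR (hN : P.Normality) (ht : 0 ≤ t) :
    ContinuousOn (P.contactR t) {0}ᶜ := by
  obtain ⟨c, F, hK⟩ := P.exists_endpoint_kernel ht
  replace hK : P.IsEndpointKernel t c F := hK
  obtain ⟨σ, hσm, hσ⟩ := P.isCompact_U.exists_measurable_isArgmax P.nonempty_U
  obtain ⟨B, hB0, hB⟩ := P.isCompact_U.isBounded.exists_pos_norm_le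
  have hm : ∀ p, Measurable fun τ => σ (costate F p τ) := fun p =>
    hσm.comp (continuous_costate hK.1 p).measurable
  have heq : Set.EqOn (P.contactR t)
      (fun p => c + ∫ τ in (0 : ℝ)..t, F τ (σ (costate F p τ))) {0}ᶜ := fun p hp =>
    hK.eq_endpoint_of_isArgmax hN ht hp (hm p) (fun τ => hσ _) (P.isArgmax_contactR ht p)
  refine ContinuousOn.congr (fun p hp => ContinuousAt.continuousWithinAt ?_) heq
  refine tendsto_const_nhds.add ?_
  refine intervalIntegral.tendsto_integral_filter_of_dominated_convergence
    (fun τ => ‖F τ‖ * B) (Eventually.of_forall fun q => ?_) (Eventually.of_forall fun q => ?_)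
    ((hK.1.norm.mul continuous_const).intervalIntegrable _ _) ?_
  · exact ((admissible_of_isArgmax (hm q) fun τ => hσ _).intervalIntegrable_kernel ht
      hK.1).aestronglyMeasurable_restrict_uIoc
  · refine ae_of_all _ fun τ _ => ((F τ).le_opNorm _).trans ?_
    gcongr
    exact hB _ (hσ _).1
  · have huniq := hK.ae_isArgmax_unique hN ht hp
    rw [← restrict_Ioc_eq_restrict_Icc, ae_restrict_iff' measurableSet_Ioc] at huniq
    filter_upwards [huniq] with τ h hτ
    rw [Set.uIoc_of_le ht] at hτ
    exact ((F τ).continuous.tendsto _).comp (tendsto_isArgmax P.isCompact_U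
      ((continuous_costate_left τ).tendsto p) (Eventually.of_forall fun q => hσ _)
      fun y hy => h hτ _ _ hy (hσ _))

end LinearTimeProblem

end

noncomputable section

variable {n : ℕ}

/-! ### The gap between target and reachable set -/

namespace LinearTimeProblem

section Gap

variable {P : LinearTimeProblem n} {t : ℝ}

lemma SimpleTarget.isArgmax_contactG (hT : P.SimpleTarget) (p : EuclideanSpace ℝ (Fin n)) :
    IsArgmax (P.G t) p (P.contactG t p) :=
  isArgmax_contactPoint ((hT t).2.1.exists_isArgmax (hT t).1 p)

lemma SimpleTarget.isArgmax_unique (hT : P.SimpleTarget) {p x y : EuclideanSpace ℝ (Fin n)}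
    (hp : p ≠ 0) (hx : IsArgmax (P.G t) p x) (hy : IsArgmax (P.G t) p y) : x = y := by
  by_contra hne
  have hz : (1 / 2 : ℝ) • x + (1 / 2 : ℝ) • y ∈ interior (P.G t) :=
    (hT t).2.2 hx.1 hy.1 hne (by norm_num) (by norm_num) (by norm_num)
  have hm : IsArgmax (P.G t) p ((1 / 2 : ℝ) • x + (1 / 2 : ℝ) • y) := by
    refine ⟨interior_subset hz, fun w hw => ?_⟩
    rw [inner_add_right, inner_smul_right, inner_smul_right]
    linarith [hx.2 w hw, hy.2 w hw]
  exact (hm.mem_frontier hp).2 hz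

lemma SimpleTarget.continuousOn_contactG (hT : P.SimpleTarget) :
    ContinuousOn (P.contactG t) {0}ᶜ := fun p hp =>
  ContinuousAt.continuousWithinAt <| tendsto_isArgmax (hT t).2.1 tendsto_id
    (Eventually.of_forall fun q => hT.isArgmax_contactG q)
    fun _ hy => hT.isArgmax_unique hp hy (hT.isArgmax_contactG p)

variable (P t) in
/-- The gap `s_{G(t)}(-p) - s_{R(t)}(p)`. -/
def gap (p : EuclideanSpace ℝ (Fin n)) : EuclideanSpace ℝ (Fin n) :=
  P.contactG t (-p) - P.contactR t p

lemma SimpleTarget.inner_gap_le_inner_sub (hT : P.SimpleTarget) (ht : 0 ≤ t)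
    (p : EuclideanSpace ℝ (Fin n)) {x y : EuclideanSpace ℝ (Fin n)} (hx : x ∈ P.reachableSet t)
    (hy : y ∈ P.G t) : inner ℝ p (P.gap t p) ≤ inner ℝ p (y - x) := by
  have h1 := (P.isArgmax_contactR ht p).2 x hx
  have h2 := (hT.isArgmax_contactG (-p)).2 y hy
  rw [inner_neg_left, inner_neg_left] at h2
  rw [gap, inner_sub_right, inner_sub_right]
  linarith

/-- The supergradient inequality for the concave function `p ↦ ⟨p, gap p⟩`. Every later estimate on
gains and derivatives combines instances of it. -/
lemma SimpleTarget.inner_gap_le (hT : P.SimpleTarget) (ht : 0 ≤ t)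
    (p q : EuclideanSpace ℝ (Fin n)) : inner ℝ p (P.gap t p) ≤ inner ℝ p (P.gap t q) :=
  hT.inner_gap_le_inner_sub ht p (P.isArgmax_contactR ht q).1 (hT.isArgmax_contactG (-q)).1

lemma SimpleTarget.gap_ne_zero (hT : P.SimpleTarget) (ht : 0 ≤ t)
    (hdisj : Disjoint (P.reachableSet t) (P.G t)) (p : EuclideanSpace ℝ (Fin n)) :
    P.gap t p ≠ 0 := fun h =>
  Set.disjoint_left.1 hdisj (P.isArgmax_contactR ht p).1
    (sub_eq_zero.1 h ▸ (hT.isArgmax_contactG (-p)).1)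

lemma SimpleTarget.continuousOn_gap (hT : P.SimpleTarget) (hN : P.Normality) (ht : 0 ≤ t) :
    ContinuousOn (P.gap t) {0}ᶜ :=
  (hT.continuousOn_contactG.comp continuous_neg.continuousOn fun p hp => by simpa using hp).sub
    (continuousOn_contactR hN ht)

lemma rhoLower_eq_inner {p : EuclideanSpace ℝ (Fin n)} (hp : ‖p‖ = 1) :
    P.rhoLower t p = inner ℝ p (P.gap t p) := by
  rw [rhoLower, hp, div_one, gap]

lemma delta_eq {p : EuclideanSpace ℝ (Fin n)} (hp : ‖p‖ = 1) :
    P.delta t p = ‖P.gap t p‖ - inner ℝ p (P.gap t p) := by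
  rw [delta, rhoLower_eq_inner hp, rhoUpper, gap]

lemma delta_nonneg {p : EuclideanSpace ℝ (Fin n)} (hp : ‖p‖ = 1) : 0 ≤ P.delta t p := by
  rw [delta_eq hp]
  have := real_inner_le_norm p (P.gap t p)
  rw [hp, one_mul] at this
  linarith

lemma SimpleTarget.continuousAt_delta (hT : P.SimpleTarget) (hN : P.Normality) (ht : 0 ≤ t)
    {p : EuclideanSpace ℝ (Fin n)} (hp : p ≠ 0) : ContinuousAt (P.delta t) p := by
  have h : ContinuousAt (P.gap t) p :=
    (hT.continuousOn_gap hN ht).continuousAt (isOpen_compl_singleton.mem_nhds hp)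
  exact h.norm.sub ((continuousAt_id.inner h).div continuousAt_id.norm (norm_ne_zero_iff.2 hp))

lemma inner_direction {p : EuclideanSpace ℝ (Fin n)} (hp : ‖p‖ = 1) (hW : P.gap t p ≠ 0) :
    inner ℝ (P.direction t p) (P.gap t p) = P.delta t p := by
  have h : ‖P.gap t p‖ ≠ 0 := norm_ne_zero_iff.2 hW
  rw [delta_eq hp, direction, ← gap, inner_sub_left, real_inner_smul_left,
    real_inner_self_eq_norm_sq]
  field_simp

lemma norm_direction_le {p : EuclideanSpace ℝ (Fin n)} (hp : ‖p‖ = 1) (hW : P.gap t p ≠ 0) :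
    ‖P.direction t p‖ ≤ 2 := by
  rw [direction, ← gap]
  refine (norm_sub_le _ _).trans ?_
  rw [norm_smul, norm_inv, norm_norm, inv_mul_cancel₀ (norm_ne_zero_iff.2 hW), hp]
  norm_num

lemma norm_add_direction_le {p : EuclideanSpace ℝ (Fin n)} (hp : ‖p‖ = 1)
    (hW : P.gap t p ≠ 0) {γ : ℝ} (hγ : γ ∈ Set.Icc (0 : ℝ) 1) :
    ‖p + γ • P.direction t p‖ ≤ 1 := by
  have e : p + γ • P.direction t p = (1 - γ) • p + γ • (‖P.gap t p‖⁻¹ • P.gap t p) := by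
    rw [direction, ← gap]; module
  rw [e]
  refine (norm_add_le _ _).trans ?_
  rw [norm_smul, norm_smul, norm_smul, norm_inv, norm_norm,
    inv_mul_cancel₀ (norm_ne_zero_iff.2 hW), hp, Real.norm_of_nonneg hγ.1,
    Real.norm_of_nonneg (sub_nonneg.2 hγ.2)]
  linarith

/-- The component along `p` is at least `1 - γ > 0`, because `ρ_lower ≥ 0` keeps the gap from
pointing against `p`. -/
lemma add_direction_ne_zero {p : EuclideanSpace ℝ (Fin n)} (hp : ‖p‖ = 1)
    (hlow : 0 ≤ P.rhoLower t p) {γ : ℝ} (hγ : γ ∈ Set.Ico (0 : ℝ) 1) :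
    p + γ • P.direction t p ≠ 0 := by
  intro h
  have h1 : inner ℝ p (p + γ • P.direction t p) = 0 := by rw [h, inner_zero_right]
  rw [rhoLower_eq_inner hp] at hlow
  rw [direction, ← gap, inner_add_right, inner_smul_right, inner_sub_right, inner_smul_right,
    real_inner_self_eq_norm_sq, hp] at h1
  have h2 : 0 ≤ γ * (‖P.gap t p‖⁻¹ * inner ℝ p (P.gap t p)) := by
    have := hγ.1
    positivity
  nlinarith [hγ.2]

/-- An envelope theorem: the contact points may be held fixed when differentiating, since they are
optimal and vary continuously. -/
lemma SimpleTarget.xiDeriv_eq (hT : P.SimpleTarget) (hN : P.Normality) (ht : 0 ≤ t)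
    {p : EuclideanSpace ℝ (Fin n)} {γ : ℝ} (h0 : p + γ • P.direction t p ≠ 0) :
    P.xiDeriv γ t p = inner ℝ (P.direction t p) (P.gap t (p + γ • P.direction t p)) := by
  set q := P.direction t p with hq
  have hφ : (fun g => P.xi g t p) =
      fun g => inner ℝ (p + g • q) (P.gap t (p + g • q)) - P.rhoLower t p := by
    funext g
    rw [xi, ← hq, rhoLower, ← gap]
    congr 1
    -- At the origin division by the zero norm gives `0`, which agrees with the inner product.
    by_cases h : p + g • q = 0
    · simp [h]
    · exact mul_div_cancel₀ _ (norm_ne_zero_iff.2 h)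
  refine HasDerivAt.deriv ?_
  rw [hφ]
  refine HasDerivAt.sub_const _ ?_
  rw [hasDerivAt_iff_isLittleO, Asymptotics.isLittleO_iff]
  intro c hc
  have hW : ContinuousAt (fun g : ℝ => P.gap t (p + g • q)) γ :=
    ContinuousAt.comp (g := P.gap t) (f := fun g : ℝ => p + g • q)
      ((hT.continuousOn_gap hN ht).continuousAt (isOpen_compl_singleton.mem_nhds h0))
      (by fun_prop)
  have hlim : Tendsto (fun g : ℝ => inner ℝ q (P.gap t (p + g • q) - P.gap t (p + γ • q)))
      (𝓝 γ) (𝓝 0) := by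
    have h : ContinuousAt
        (fun g : ℝ => inner ℝ q (P.gap t (p + g • q) - P.gap t (p + γ • q))) γ :=
      continuousAt_const.inner (hW.sub continuousAt_const)
    have h' := h.tendsto
    rwa [sub_self, inner_zero_right] at h'
  filter_upwards [Metric.tendsto_nhds.1 hlim c hc] with g hg
  rw [Real.dist_eq, sub_zero] at hg
  -- These two inequalities trap the linearization error between `(g - γ) ⟨q, gap (p + g q) - gap (p
  -- + γ q)⟩` and `0`.
  have a1 := hT.inner_gap_le ht (p + g • q) (p + γ • q)
  have a2 := hT.inner_gap_le ht (p + γ • q) (p + g • q)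
  have e : |(g - γ) * inner ℝ q (P.gap t (p + g • q) - P.gap t (p + γ • q))| ≤ c * |g - γ| := by
    rw [abs_mul, mul_comm c]
    gcongr
  refine le_trans ?_ e
  rw [Real.norm_eq_abs, smul_eq_mul]
  simp only [inner_add_left, real_inner_smul_left, inner_sub_right] at a1 a2 ⊢
  rw [abs_of_nonpos (by linarith)]
  refine le_trans ?_ (neg_le_abs _)
  linarith

/-- Concavity estimate for the gain of a step. -/
lemma SimpleTarget.inner_gap_add_le (hT : P.SimpleTarget) (ht : 0 ≤ t)
    (p q : EuclideanSpace ℝ (Fin n)) {β γ κ : ℝ} (hβ : 0 ≤ β) (hβγ : β ≤ γ)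
    (hγ : 0 ≤ inner ℝ q (P.gap t (p + γ • q))) (hκ : κ ≤ inner ℝ q (P.gap t (p + β • q))) :
    inner ℝ p (P.gap t p) + β * κ ≤ inner ℝ (p + γ • q) (P.gap t (p + γ • q)) := by
  -- `a2` gives slope at least `κ` on `[0, β]`, and `a1` a nonnegative slope on `[β, γ]`. A long
  -- step thus gains at least as much as is certified at a short one.
  have a1 := hT.inner_gap_le ht (p + β • q) (p + γ • q)
  have a2 := hT.inner_gap_le ht p (p + β • q)
  simp only [inner_add_left, real_inner_smul_left] at a1 ⊢
  have b1 := mul_le_mul_of_nonneg_left hκ hβ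
  have b2 := mul_nonneg (sub_nonneg.2 hβγ) hγ
  linarith

lemma SimpleTarget.rhoLower_normalize_ge (hT : P.SimpleTarget) (ht : 0 ≤ t)
    {x : EuclideanSpace ℝ (Fin n)} (hx : x ≠ 0) (hx1 : ‖x‖ ≤ 1)
    (hnn : 0 ≤ inner ℝ x (P.gap t x)) :
    inner ℝ x (P.gap t x) ≤ P.rhoLower t (‖x‖⁻¹ • x) := by
  have hpos : 0 < ‖x‖ := norm_pos_iff.2 hx
  have h1 : ‖‖x‖⁻¹ • x‖ = 1 := norm_smul_inv_norm (𝕜 := ℝ) hx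
  rw [rhoLower_eq_inner h1, real_inner_smul_left]
  calc inner ℝ x (P.gap t x) ≤ ‖x‖⁻¹ * inner ℝ x (P.gap t x) :=
        le_mul_of_one_le_left hnn ((one_le_inv₀ hpos).2 hx1)
    _ ≤ _ := by
        gcongr
        exact hT.inner_gap_le ht x _

/-- For small steps the derivative of the gain is bounded from below, uniformly in `p`. -/
lemma SimpleTarget.exists_step_bound (hT : P.SimpleTarget) (hN : P.Normality) (ht : 0 ≤ t)
    (hdisj : Disjoint (P.reachableSet t) (P.G t)) {ε : ℝ} (hε : 0 < ε) :
    ∃ γ' : ℝ, 0 < γ' ∧ ∀ p, ‖p‖ = 1 → ε ≤ P.delta t p → ∀ γ ∈ Set.Icc 0 γ',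
      ε / 2 ≤ inner ℝ (P.direction t p) (P.gap t (p + γ • P.direction t p)) := by
  have hK : IsCompact {x : EuclideanSpace ℝ (Fin n) | 1 / 2 ≤ ‖x‖ ∧ ‖x‖ ≤ 2} := by
    refine (isCompact_closedBall (0 : EuclideanSpace ℝ (Fin n)) 2).of_isClosed_subset
      ((isClosed_le continuous_const continuous_norm).inter
        (isClosed_le continuous_norm continuous_const)) fun x hx => ?_
    simpa using hx.2
  have huc := hK.uniformContinuousOn_of_continuous ((hT.continuousOn_gap hN ht).mono
    fun x hx h => by
      rw [Set.mem_singleton_iff] at h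
      have := hx.1
      rw [h, norm_zero] at this
      norm_num at this)
  obtain ⟨η, hη, h⟩ := Metric.uniformContinuousOn_iff.1 huc (ε / 4) (by positivity)
  -- As `‖q‖ ≤ 2`, the bound `1/4` keeps `p + γ q` in the annulus and `η/4` keeps its distance from
  -- `p` below `η`. Then `⟨q, gap⟩` changes by at most `2 · ε/4` from its value `δ` at `γ = 0`.
  refine ⟨min (1 / 4) (η / 4), by positivity, fun p hp hδ γ hγ => ?_⟩
  have hW := hT.gap_ne_zero ht hdisj p
  have hq := norm_direction_le hp hW
  have hγ1 : γ ≤ 1 / 4 := hγ.2.trans (min_le_left _ _)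
  have hγ2 : γ ≤ η / 4 := hγ.2.trans (min_le_right _ _)
  have hs : ‖γ • P.direction t p‖ ≤ 2 * γ := by
    rw [norm_smul, Real.norm_of_nonneg hγ.1]
    nlinarith [hγ.1]
  have hlo : 1 / 2 ≤ ‖p + γ • P.direction t p‖ := by
    have := norm_sub_norm_le p (-(γ • P.direction t p))
    rw [norm_neg, hp, sub_neg_eq_add] at this
    linarith
  have hhi : ‖p + γ • P.direction t p‖ ≤ 2 := by
    have := norm_add_le p (γ • P.direction t p)
    rw [hp] at this
    linarith
  have hd := h (p + γ • P.direction t p) ⟨hlo, hhi⟩ p ⟨by rw [hp]; norm_num, by rw [hp]; norm_num⟩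
    (by rw [dist_eq_norm, add_sub_cancel_left]; linarith)
  rw [dist_eq_norm] at hd
  have h1 := abs_real_inner_le_norm (P.direction t p)
    (P.gap t (p + γ • P.direction t p) - P.gap t p)
  have h2 : ‖P.direction t p‖ * ‖P.gap t (p + γ • P.direction t p) - P.gap t p‖ ≤ 2 * (ε / 4) :=
    mul_le_mul hq hd.le (norm_nonneg _) (by norm_num)
  have h3 := neg_le_of_abs_le (h1.trans h2)
  rw [inner_sub_right, inner_direction hp hW] at h3
  linarith

lemma SimpleTarget.exists_norm_gap_bound (hT : P.SimpleTarget) (hN : P.Normality) (ht : 0 ≤ t)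
    (hdisj : Disjoint (P.reachableSet t) (P.G t)) :
    ∃ m : ℝ, 0 < m ∧ ∀ p, ‖p‖ = 1 → m ≤ ‖P.gap t p‖ := by
  by_cases hne : (Metric.sphere (0 : EuclideanSpace ℝ (Fin n)) 1).Nonempty
  · have hc : ContinuousOn (fun p => ‖P.gap t p‖) (Metric.sphere 0 1) :=
      ((hT.continuousOn_gap hN ht).mono fun p hp h => by
        rw [Set.mem_singleton_iff] at h
        simp [h] at hp).norm
    obtain ⟨p₀, _, hmin⟩ := (isCompact_sphere 0 1).exists_isMinOn hne hc
    exact ⟨‖P.gap t p₀‖, norm_pos_iff.2 (hT.gap_ne_zero ht hdisj p₀),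
      fun p hp => hmin (by simpa using hp)⟩
  · exact ⟨1, one_pos, fun p hp => absurd ⟨p, by simpa using hp⟩ hne⟩

/-- `gap 0` is merely the difference of some point of `G(t)` and some point of `R(t)`; it serves as
a bound independent of `p`. -/
lemma SimpleTarget.rhoLower_le (hT : P.SimpleTarget) (ht : 0 ≤ t)
    {p : EuclideanSpace ℝ (Fin n)} (hp : ‖p‖ = 1) : P.rhoLower t p ≤ ‖P.gap t 0‖ := by
  rw [rhoLower_eq_inner hp]
  refine (hT.inner_gap_le ht p 0).trans ((real_inner_le_norm _ _).trans ?_)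
  rw [hp, one_mul]

/-- At most one unit vector has `δ = 0`. -/
lemma SimpleTarget.eq_of_delta_eq_zero (hT : P.SimpleTarget) (ht : 0 ≤ t)
    (hdisj : Disjoint (P.reachableSet t) (P.G t)) {p q : EuclideanSpace ℝ (Fin n)}
    (hp : ‖p‖ = 1) (hq : ‖q‖ = 1) (hδp : P.delta t p = 0) (hδq : P.delta t q = 0) : p = q := by
  have key : ∀ {p : EuclideanSpace ℝ (Fin n)}, ‖p‖ = 1 → P.delta t p = 0 →
      P.gap t p = ‖P.gap t p‖ • p := fun {p} hp hδ => by
    rw [delta_eq hp, sub_eq_zero] at hδ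
    have := (inner_eq_norm_mul_iff_real (x := p) (y := P.gap t p)).1 (by rw [hp, one_mul, hδ])
    rw [hp, one_smul] at this
    exact this.symm
  have ha : 0 < ‖P.gap t p‖ := norm_pos_iff.2 (hT.gap_ne_zero ht hdisj p)
  have hb : 0 < ‖P.gap t q‖ := norm_pos_iff.2 (hT.gap_ne_zero ht hdisj q)
  have h1 := hT.inner_gap_le ht p q
  have h2 := hT.inner_gap_le ht q p
  -- With `a`, `b` the gap norms and `c = ⟨p, q⟩ ≤ 1`, this reads `a ≤ b c` and `b ≤ a c`, which
  -- forces `c = 1`.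
  rw [key hp hδp, key hq hδq] at h1 h2
  simp only [inner_smul_right, real_inner_self_eq_norm_sq, hp, hq] at h1 h2
  rw [real_inner_comm] at h2
  have hc := real_inner_le_norm p q
  rw [hp, hq] at hc
  refine (inner_eq_one_iff_of_norm_eq_one (𝕜 := ℝ) hp hq).1 (le_antisymm (by linarith) ?_)
  by_contra! hlt
  nlinarith

end Gap

end LinearTimeProblem

end

noncomputable section

variable {n : ℕ}

/-! ### Termination and convergence of the algorithm -/

namespace LinearTimeProblem

section Algorithm

variable {P : LinearTimeProblem n} {t : ℝ}

variable (P t) in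
/-- States `(p, γ)` with a unit vector `p`, `ρ_lower ≥ 0` and step size in `[g, 1)`. -/
def Feasible (g : ℝ) (x : EuclideanSpace ℝ (Fin n) × ℝ) : Prop :=
  ‖x.1‖ = 1 ∧ 0 ≤ P.rhoLower t x.1 ∧ g ≤ x.2 ∧ x.2 < 1

variable (P t) in
/-- The normalized update of `p` with step size `γ`. -/
def update (p : EuclideanSpace ℝ (Fin n)) (γ : ℝ) : EuclideanSpace ℝ (Fin n) :=
  ‖p + γ • P.direction t p‖⁻¹ • (p + γ • P.direction t p)

lemma SimpleTarget.update_spec (hT : P.SimpleTarget) (hN : P.Normality) (ht : 0 ≤ t)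
    (hdisj : Disjoint (P.reachableSet t) (P.G t)) {p : EuclideanSpace ℝ (Fin n)} (hp : ‖p‖ = 1)
    (hlow : 0 ≤ P.rhoLower t p) {β γ κ : ℝ} (hγ : γ ∈ Set.Ico (0 : ℝ) 1)
    (hξ : 0 ≤ P.xiDeriv γ t p) (hβ : 0 ≤ β) (hβγ : β ≤ γ) (hκ0 : 0 ≤ κ)
    (hκ : κ ≤ inner ℝ (P.direction t p) (P.gap t (p + β • P.direction t p))) :
    ‖P.update t p γ‖ = 1 ∧ P.rhoLower t p + β * κ ≤ P.rhoLower t (P.update t p γ) := by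
  have h0 := add_direction_ne_zero hp hlow hγ
  rw [hT.xiDeriv_eq hN ht h0] at hξ
  have hgain := hT.inner_gap_add_le ht p (P.direction t p) hβ hβγ hξ hκ
  rw [← rhoLower_eq_inner hp] at hgain
  have h1 := norm_add_direction_le hp (hT.gap_ne_zero ht hdisj p) ⟨hγ.1, hγ.2.le⟩
  refine ⟨norm_smul_inv_norm (𝕜 := ℝ) h0, hgain.trans (hT.rhoLower_normalize_ge ht h0 h1 ?_)⟩
  exact (add_nonneg hlow (mul_nonneg hβ hκ0)).trans hgain

lemma SimpleTarget.feasible_saStep (hT : P.SimpleTarget) (hN : P.Normality) (ht : 0 ≤ t)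
    (hdisj : Disjoint (P.reachableSet t) (P.G t)) {keep : Bool} {α γ₀ : ℝ}
    (hγ₀ : γ₀ ∈ Set.Ioo (0 : ℝ) 1) {x : EuclideanSpace ℝ (Fin n) × ℝ}
    (hx : P.Feasible t 0 x) : P.Feasible t 0 (P.saStep keep α t γ₀ x) := by
  obtain ⟨hp, hlow, hg, hg1⟩ := hx
  unfold saStep
  split_ifs with h1 h2 h3
  · exact ⟨hp, hlow, by simp only; linarith, by simp only; linarith⟩
  all_goals first
    | exact ⟨hp, hlow, hg, hg1⟩
    | have h0 := add_direction_ne_zero hp hlow ⟨hg, hg1⟩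
      have hξ := not_lt.1 h2
      obtain ⟨u1, u2⟩ := hT.update_spec hN ht hdisj hp hlow ⟨hg, hg1⟩ hξ hg le_rfl hξ
        (hT.xiDeriv_eq hN ht h0).le
      have u3 : 0 ≤ P.rhoLower t (P.update t x.1 x.2) :=
        (add_nonneg hlow (mul_nonneg hg hξ)).trans u2
      first
        | exact ⟨u1, u3, hg, hg1⟩
        | exact ⟨u1, u3, hγ₀.1.le, hγ₀.2⟩

lemma SimpleTarget.feasible_saState (hT : P.SimpleTarget) (hN : P.Normality) (ht : 0 ≤ t)
    (hdisj : Disjoint (P.reachableSet t) (P.G t)) (keep : Bool) (α : ℝ) {γ : ℝ}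
    (hγ : γ ∈ Set.Ioo (0 : ℝ) 1) {p : EuclideanSpace ℝ (Fin n)} (hp : ‖p‖ = 1)
    (hlow : 0 ≤ P.rhoLower t p) (k : ℕ) : P.Feasible t 0 (P.saState keep α t p γ k) := by
  induction k with
  | zero => exact ⟨hp, hlow, hγ.1.le, hγ.2⟩
  | succ k ih =>
    rw [saState, Function.iterate_succ_apply']
    exact hT.feasible_saStep hN ht hdisj hγ ih

/-- A potential that increases by a fixed amount in every elementary step before the stop. -/
lemma SimpleTarget.exists_potential (hT : P.SimpleTarget) (hN : P.Normality) (ht : 0 ≤ t)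
    (hdisj : Disjoint (P.reachableSet t) (P.G t)) (keep : Bool) {α γ₀ : ℝ} (hα : 0 < α)
    (hγ₀ : γ₀ ∈ Set.Ioo (0 : ℝ) 1) :
    ∃ C g : ℝ, 0 < C ∧ 0 < g ∧ g ≤ γ₀ ∧ ∀ x, P.Feasible t g x →
      P.delta t x.1 > α * P.rhoLower t x.1 → P.Feasible t g (P.saStep keep α t γ₀ x) ∧
        C * P.rhoLower t x.1 - x.2 + g / 2 ≤
          C * P.rhoLower t (P.saStep keep α t γ₀ x).1 - (P.saStep keep α t γ₀ x).2 := by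
  obtain ⟨m, hm0, hm⟩ := hT.exists_norm_gap_bound hN ht hdisj
  -- Obtained by solving `δ ≥ m - ρ_lower > m - δ / α` for `δ`.
  set ε := m * α / (1 + α) with hε
  have hε0 : 0 < ε := by positivity
  obtain ⟨γ', hγ'0, hγ'⟩ := hT.exists_step_bound hN ht hdisj hε0
  have hg0 : 0 < min γ₀ (γ' / 2) := lt_min hγ₀.1 (by positivity)
  have hgγ₀ : min γ₀ (γ' / 2) ≤ γ₀ := min_le_left _ _
  have hgγ' : min γ₀ (γ' / 2) ≤ γ' / 2 := min_le_right _ _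
  set g := min γ₀ (γ' / 2)
  -- A move raises `ρ_lower` by at least `g ε / 2`, so the first term of the potential grows by `2`,
  -- which outweighs a reset of the step size (below `1`) plus `g / 2`. A halving lowers the step
  -- size by at least `g / 2`, and happens only above `γ'`, so the result stays above `g`.
  refine ⟨4 / (g * ε), g, by positivity, hg0, hgγ₀, fun x hx hδ => ?_⟩
  obtain ⟨hp, hlow, hg, hg1⟩ := hx
  have hx0 : 0 ≤ x.2 := hg0.le.trans hg
  have hδε : ε ≤ P.delta t x.1 := by
    have h1 := hm x.1 hp
    have h2 := delta_eq (P := P) (t := t) hp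
    rw [← rhoLower_eq_inner hp] at h2
    rw [hε, div_le_iff₀ (by positivity)]
    nlinarith
  have h0 := add_direction_ne_zero hp hlow ⟨hx0, hg1⟩
  unfold saStep
  rw [if_pos hδ]
  by_cases h2 : P.xiDeriv x.2 t x.1 < 0
  · rw [if_pos h2]
    have hlarge : γ' < x.2 := by
      by_contra! hle
      have h3 := hγ' x.1 hp hδε x.2 ⟨hx0, hle⟩
      rw [hT.xiDeriv_eq hN ht h0] at h2
      linarith
    refine ⟨⟨hp, hlow, ?_, ?_⟩, ?_⟩ <;> simp only <;> linarith
  · rw [if_neg h2]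
    have h3 := hγ' x.1 hp hδε g ⟨hg0.le, by linarith⟩
    obtain ⟨u1, u2⟩ := hT.update_spec hN ht hdisj hp hlow ⟨hx0, hg1⟩ (not_lt.1 h2) hg0.le hg
      (by positivity) h3
    have hs : g ≤ (if keep = true then x.2 else γ₀) ∧ (if keep = true then x.2 else γ₀) < 1 := by
      split_ifs
      · exact ⟨hg, hg1⟩
      · exact ⟨hgγ₀, hγ₀.2⟩
    have hnn : 0 ≤ P.rhoLower t (P.update t x.1 x.2) :=
      (add_nonneg hlow (by positivity)).trans u2
    refine ⟨⟨u1, hnn, hs.1, hs.2⟩, ?_⟩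
    change _ ≤ 4 / (g * ε) * P.rhoLower t (P.update t x.1 x.2) - _
    have h4 : 4 / (g * ε) * (P.rhoLower t x.1 + g * (ε / 2)) ≤
        4 / (g * ε) * P.rhoLower t (P.update t x.1 x.2) := by gcongr
    have h5 : 4 / (g * ε) * (P.rhoLower t x.1 + g * (ε / 2)) =
        4 / (g * ε) * P.rhoLower t x.1 + 2 := by field_simp; ring
    have h6 := hs.2
    have h7 := hγ₀.2
    linarith

/-- The algorithm stops after finitely many elementary steps. -/
theorem SimpleTarget.exists_saHalted (hT : P.SimpleTarget) (hN : P.Normality) (ht : 0 ≤ t)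
    (hdisj : Disjoint (P.reachableSet t) (P.G t)) (keep : Bool) {α : ℝ} (hα : 0 < α) {γ : ℝ}
    (hγ : γ ∈ Set.Ioo (0 : ℝ) 1) {p : EuclideanSpace ℝ (Fin n)} (hp : ‖p‖ = 1)
    (hlow : 0 ≤ P.rhoLower t p) : ∃ k, P.SAHalted keep α t p γ k := by
  by_contra! hrun
  simp only [SAHalted, not_not] at hrun
  obtain ⟨C, g, hC, hg, hgγ, hstep⟩ := hT.exists_potential hN ht hdisj keep hα hγ
  set x := P.saState keep α t p γ with hx
  have hsucc : ∀ k, x (k + 1) = P.saStep keep α t γ (x k) := fun k => by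
    rw [hx, saState, Function.iterate_succ_apply']; rfl
  have hinv : ∀ k : ℕ, P.Feasible t g (x k) ∧
      C * P.rhoLower t p - γ + k * (g / 2) ≤ C * P.rhoLower t (x k).1 - (x k).2 := by
    intro k
    induction k with
    | zero => exact ⟨⟨hp, hlow, hgγ, hγ.2⟩, by simp [hx, saState]⟩
    | succ k ih =>
      obtain ⟨h1, h2⟩ := hstep (x k) ih.1 (hrun k)
      rw [hsucc]
      refine ⟨h1, le_trans ?_ h2⟩
      push_cast
      linarith [ih.2]
  obtain ⟨k, hk⟩ := exists_nat_gt ((C * ‖P.gap t 0‖ + 1) / (g / 2))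
  rw [div_lt_iff₀ (by positivity)] at hk
  obtain ⟨⟨h1, h2, h3, h4⟩, h5⟩ := hinv k
  have h6 : C * P.rhoLower t (x k).1 ≤ C * ‖P.gap t 0‖ := by
    gcongr
    exact hT.rhoLower_le ht h1
  have h7 : 0 ≤ C * P.rhoLower t p := by positivity
  linarith [hγ.2]

theorem SimpleTarget.saOutput_spec (hT : P.SimpleTarget) (hN : P.Normality) (ht : 0 ≤ t)
    (hdisj : Disjoint (P.reachableSet t) (P.G t)) (keep : Bool) {α : ℝ} (hα : 0 < α) {γ : ℝ}
    (hγ : γ ∈ Set.Ioo (0 : ℝ) 1) {p : EuclideanSpace ℝ (Fin n)} (hp : ‖p‖ = 1)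
    (hlow : 0 ≤ P.rhoLower t p) :
    ‖P.saOutput keep α t p γ‖ = 1 ∧
      P.delta t (P.saOutput keep α t p γ) ≤ α * P.rhoLower t (P.saOutput keep α t p γ) := by
  classical
  have h := hT.exists_saHalted hN ht hdisj keep hα hγ hp hlow
  rw [saOutput, dif_pos h]
  exact ⟨(hT.feasible_saState hN ht hdisj keep α hγ hp hlow _).1, not_lt.1 (Nat.find_spec h)⟩

/-- The outputs converge to a unit vector with `δ = 0` as the tolerance tends to zero. -/
theorem SimpleTarget.exists_tendsto_saOutput (hT : P.SimpleTarget) (hN : P.Normality)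
    (ht : 0 ≤ t) (hdisj : Disjoint (P.reachableSet t) (P.G t)) (keep : Bool) {γ : ℝ}
    (hγ : γ ∈ Set.Ioo (0 : ℝ) 1) {p : EuclideanSpace ℝ (Fin n)} (hp : ‖p‖ = 1)
    (hlow : 0 ≤ P.rhoLower t p) :
    ∃ p', Tendsto (fun α => P.saOutput keep α t p γ) (𝓝[>] (0 : ℝ)) (𝓝 p') ∧ ‖p'‖ = 1 ∧
      P.delta t p' = 0 := by
  have hspec : ∀ᶠ α in 𝓝[>] (0 : ℝ), P.saOutput keep α t p γ ∈ Metric.sphere 0 1 ∧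
      P.delta t (P.saOutput keep α t p γ) ≤ α * ‖P.gap t 0‖ := by
    filter_upwards [self_mem_nhdsWithin] with α hα
    obtain ⟨h1, h2⟩ := hT.saOutput_spec hN ht hdisj keep hα hγ hp hlow
    refine ⟨by simpa using h1, h2.trans ?_⟩
    have : 0 < α := hα
    gcongr
    exact hT.rhoLower_le ht h1
  have hcl : ∀ y ∈ Metric.sphere (0 : EuclideanSpace ℝ (Fin n)) 1,
      MapClusterPt y (𝓝[>] (0 : ℝ)) (fun α => P.saOutput keep α t p γ) → P.delta t y = 0 := by
    intro y hy hcl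
    have hy1 : ‖y‖ = 1 := by simpa using hy
    have hy0 : y ≠ 0 := norm_ne_zero_iff.1 (by rw [hy1]; exact one_ne_zero)
    obtain ⟨f, hf, hfy⟩ := mapClusterPt_iff_ultrafilter.1 hcl
    have h1 : Tendsto (fun α => P.delta t (P.saOutput keep α t p γ)) f (𝓝 (P.delta t y)) :=
      (hT.continuousAt_delta hN ht hy0).tendsto.comp hfy
    have h2 : Tendsto (fun α : ℝ => α * ‖P.gap t 0‖) f (𝓝 0) := by
      have h3 : Tendsto (fun α : ℝ => α * ‖P.gap t 0‖) (𝓝 0) (𝓝 (0 * ‖P.gap t 0‖)) :=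
        (continuous_id.mul continuous_const).tendsto 0
      rw [zero_mul] at h3
      exact h3.mono_left (hf.trans nhdsWithin_le_nhds)
    exact le_antisymm (le_of_tendsto_of_tendsto h1 h2 (hf (hspec.mono fun _ h => h.2)))
      (delta_nonneg hy1)
  have hmem : ∀ᶠ α in 𝓝[>] (0 : ℝ), P.saOutput keep α t p γ ∈ Metric.sphere 0 1 :=
    hspec.mono fun _ h => h.1
  obtain ⟨p', hp', hclp⟩ := (isCompact_sphere (0 : EuclideanSpace ℝ (Fin n)) 1).exists_mapClusterPt
    (tendsto_principal.2 hmem)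
  have h1 : ‖p'‖ = 1 := by simpa using hp'
  have h2 := hcl p' hp' hclp
  -- The limit exists although the output need not depend continuously on `α`: all cluster points on
  -- the compact sphere coincide.
  refine ⟨p', (isCompact_sphere _ 1).tendsto_nhds_of_unique_mapClusterPt hmem fun y hy hy' => ?_,
    h1, h2⟩
  exact hT.eq_of_delta_eq_zero ht hdisj (by simpa using hy) h1 (hcl y hy hy') h2

end Algorithm

end LinearTimeProblem

end

/-! ### Conclusion: an aligned gap realizes the distance -/

theorem mainTheorem2 {n : ℕ} (P : LinearTimeProblem n)
    (hRP1 : P.Normality) (hRT1 : P.SimpleTarget)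
    (t : ℝ) (ht : 0 ≤ t)
    (p : EuclideanSpace ℝ (Fin n)) (hp : ‖p‖ = 1) (hlow : 0 ≤ P.rhoLower t p)
    (γ : ℝ) (hγ : γ ∈ Set.Ioo (0 : ℝ) 1)
    (hdisj : Disjoint (P.reachableSet t) (P.G t)) (keep : Bool) :
    (∀ α : ℝ, 0 < α →
      (∃ k, P.SAHalted keep α t p γ k) ∧
      P.delta t (P.saOutput keep α t p γ) ≤ α * P.rhoLower t (P.saOutput keep α t p γ)) ∧
    ∃ p' : EuclideanSpace ℝ (Fin n),
      Tendsto (fun α => P.saOutput keep α t p γ) (𝓝[>] (0 : ℝ)) (𝓝 p') ∧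
      ‖p'‖ = 1 ∧ P.delta t p' = 0 ∧ 0 < P.rhoLower t p' ∧
      P.contactR t p' ∈ P.reachableSet t ∧ P.contactG t (-p') ∈ P.G t ∧
      ∀ x ∈ P.reachableSet t, ∀ y ∈ P.G t,
        ‖P.contactG t (-p') - P.contactR t p'‖ ≤ ‖y - x‖ := by
  refine ⟨fun α hα => ⟨hRT1.exists_saHalted hRP1 ht hdisj keep hα hγ hp hlow,
    (hRT1.saOutput_spec hRP1 ht hdisj keep hα hγ hp hlow).2⟩, ?_⟩
  obtain ⟨p', hlim, hp', hδ⟩ := hRT1.exists_tendsto_saOutput hRP1 ht hdisj keep hγ hp hlow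
  have hgap : inner ℝ p' (P.gap t p') = ‖P.gap t p'‖ := by
    rw [LinearTimeProblem.delta_eq hp'] at hδ
    linarith
  refine ⟨p', hlim, hp', hδ, ?_, (P.isArgmax_contactR ht p').1, (hRT1.isArgmax_contactG (-p')).1,
    fun x hx y hy => ?_⟩
  · rw [LinearTimeProblem.rhoLower_eq_inner hp', hgap]
    exact norm_pos_iff.2 (hRT1.gap_ne_zero ht hdisj p')
  -- Weak duality: `‖gap p'‖ = ⟨p', gap p'⟩ ≤ ⟨p', y - x⟩ ≤ ‖y - x‖`.
  · have h := (hRT1.inner_gap_le_inner_sub ht p' hx hy).trans (real_inner_le_norm p' (y - x))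
    rw [hgap, hp', one_mul] at h
    exact h
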